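/- Fix $d\ge 1$. Cubes in $\mathbb R^d$ are half-open with sides parallel to the axes, and $\ell(Q)=|Q|^{1/d}$. A dyadic grid is a collection $\mathcal D$ of cubes, with side lengths differing from one another by integer powers of $2$, such that for every $Q\in\mathcal D$ the cubes $Q'\in\mathcal D$ with $|Q'|=|Q|$ partition $\mathbb R^d$ and $Q$ is the union of $2^d$ cubes of $\mathcal D$, each of volume $2^{-d}|Q|$. For integers $m,n\ge 0$, a linear operator $\mathbb S$ on $L^2(\mathbb R^d)$ (real-valued functions) is a (generalized) Haar shift operator of complexity type $(m,n)$ if, for some dyadic grid $\mathcal D$, $$\mathbb S f(x)=\sum_{Q\in\mathcal D}\mathbb S_Q f(x),\qquad \mathbb S_Q f(x)=\int_Q s_Q(x,y)f(y)\,dy ,$$ with unconditional convergence in $L^2(\mathbb R^d)$, where (1) $s_Q$ is supported on $Q\times Q$ and $\|s_Q\|_\infty\le 1/|Q|$; (2) $s_Q$ is constant on $R\times T$ for all $R,T\in\mathcal D$ with $R,T\subset Q$, $\ell(R)\le 2^{-m}\ell(Q)$ and $\ell(T)\le 2^{-n}\ell(Q)$; (3) for every $\mathcal D'\subset\mathcal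 D$ and every $f\in L^2(\mathbb R^d)$, the series $\sum_{Q\in\mathcal D'}\mathbb S_Q f$ converges unconditionally in $L^2(\mathbb R^d)$ and $\bigl\|\sum_{Q\in\mathcal D'}\mathbb S_Q f\bigr\|_2\le\|f\|_2$. Its complexity is $\kappa=1+\max(m,n)$. A measurable function $w$ on $\mathbb R^d$ with $w>0$ a.e. is in $A_2$ if $$[w]_{A_2}=\sup_Q \frac{1}{|Q|}\int_Q w\,dx\cdot\frac1{|Q|}\int_Q w^{-1}\,dx<\infty ,$$ the supremum being over all cubes $Q$. Write $\|f\|_{L^2(w)}=\bigl(\int f^2\,w\,dx\bigr)^{1/2}$. Theorem. There is a constant $C$, depending only on $d$, such that for every Haar shift operator $\mathbb S$ of complexity $\kappa$, every $w\in A_2$ and every $f\in L^2(w)$, the series $\mathbb S f=\sum_{Q\in\mathcal D}\mathbb S_Q f$ converges unconditionally in $L^2(w)$, agrees a.e. with the given operator $\mathbb S$ when also $f\in L^2(\mathbb R^d)$, and satisfies $$\|\mathbb S f\|_{L^2(w)}\le C\,\kappa\,[w]_{A_2}\,\|f\|_{L^2(w)} .$$ -/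

import Mathlib

open MeasureTheory Filter Topology
open scoped ENNReal NNReal

namespace HaarShift

/-- A cube in `ℝ^d` with sides parallel to the axes, given by its lower corner and side length. -/
@[ext] structure Cube (d : ℕ) where
  corner : Fin d → ℝ
  side : ℝ
  side_pos : 0 < side

/-- The half-open point set `∏ i, [a i, a i + ℓ)` of a cube. -/
def Cube.toSet {d : ℕ} (Q : Cube d) : Set (Fin d → ℝ) :=
  Set.univ.pi fun i => Set.Ico (Q.corner i) (Q.corner i + Q.side)

/-- The Lebesgue measure `|Q|` of a cube, as a real number; thus `ℓ(Q) = |Q|^{1/d} = Q.side`. -/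
noncomputable def Cube.vol {d : ℕ} (Q : Cube d) : ℝ := volume.real Q.toSet

/-- A dyadic grid. Half-open cubes are used, so that the partition is exact. -/
structure IsDyadicGrid {d : ℕ} (D : Set (Cube d)) : Prop where
  /-- The side lengths of two cubes of the grid differ by an integer power of two. -/
  dyadic_scales : ∀ Q ∈ D, ∀ Q' ∈ D, ∃ k : ℤ, Q'.side = (2 : ℝ) ^ k * Q.side
  /-- The cubes of the grid of the same volume as `Q` partition `ℝ^d`. -/
  partition : ∀ Q ∈ D, ∀ x : Fin d → ℝ, ∃! Q' : Cube d, Q' ∈ D ∧ Q'.vol = Q.vol ∧ x ∈ Q'.toSet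
  /-- Each `Q` is the union of `2^d` cubes of the grid of volume `2^{-d}|Q|`. -/
  children : ∀ Q ∈ D, ∃ Ch : Finset (Cube d), (∀ Q' ∈ Ch, Q' ∈ D) ∧ Ch.card = 2 ^ d ∧
    (∀ Q' ∈ Ch, Q'.vol = Q.vol / 2 ^ d) ∧ Q.toSet = ⋃ Q' ∈ Ch, Q'.toSet

/-- The component `S_Q f (x) = ∫_Q s_Q(x,y) f(y) dy`. -/
noncomputable def component {d : ℕ} (s : Cube d → (Fin d → ℝ) → (Fin d → ℝ) → ℝ) (Q : Cube d)
    (f : (Fin d → ℝ) → ℝ) : (Fin d → ℝ) → ℝ :=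
  fun x => ∫ y in Q.toSet, s Q x y * f y

/-- `g = ∑_{Q ∈ D} u_Q` with unconditional convergence in `L²(μ)`: the net of the sums over
finite subsets of `D` converges to `g` in the norm of `L²(μ)`. -/
def HasL2Sum {d : ℕ} (μ : Measure (Fin d → ℝ)) (D : Set (Cube d))
    (u : Cube d → (Fin d → ℝ) → ℝ) (g : (Fin d → ℝ) → ℝ) : Prop :=
  Tendsto (fun F : Finset D => eLpNorm (fun x => g x - ∑ Q ∈ F, u Q x) 2 μ) atTop (𝓝 0)

/-- `S` is a (generalized) Haar shift operator of complexity type `(m, n)` over the dyadic grid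
`D`, with kernels `s Q`, `Q ∈ D`. -/
structure IsHaarShift {d : ℕ} (D : Set (Cube d)) (m n : ℕ)
    (s : Cube d → (Fin d → ℝ) → (Fin d → ℝ) → ℝ)
    (S : Lp ℝ 2 (volume : Measure (Fin d → ℝ)) →ₗ[ℝ] Lp ℝ 2 (volume : Measure (Fin d → ℝ))) :
    Prop where
  grid : IsDyadicGrid D
  /-- `S f = ∑_{Q ∈ D} S_Q f`. -/
  sum_eq : ∀ f : Lp ℝ 2 (volume : Measure (Fin d → ℝ)),
    HasL2Sum volume D (fun Q => component s Q f) (S f)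
  /-- `s_Q` is supported on `Q × Q`. -/
  support : ∀ Q ∈ D, ∀ x y, s Q x y ≠ 0 → x ∈ Q.toSet ∧ y ∈ Q.toSet
  /-- `‖s_Q‖_∞ ≤ 1 / |Q|`. -/
  bound : ∀ Q ∈ D, ∀ x y, |s Q x y| ≤ 1 / Q.vol
  /-- `s_Q` is constant on dyadic rectangles `R × T ⊆ Q × Q` with `ℓ(R) ≤ 2^{-m} ℓ(Q)` and
  `ℓ(T) ≤ 2^{-n} ℓ(Q)`. -/
  const_on : ∀ Q ∈ D, ∀ R ∈ D, ∀ T ∈ D, R.toSet ⊆ Q.toSet → T.toSet ⊆ Q.toSet →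
    R.side ≤ Q.side / 2 ^ m → T.side ≤ Q.side / 2 ^ n →
    ∀ x ∈ R.toSet, ∀ x' ∈ R.toSet, ∀ y ∈ T.toSet, ∀ y' ∈ T.toSet, s Q x y = s Q x' y'
  /-- For every subset `D'` of `D`, `‖∑_{Q ∈ D'} S_Q f‖₂ ≤ ‖f‖₂`. -/
  unconditional : ∀ D' ⊆ D, ∀ f : Lp ℝ 2 (volume : Measure (Fin d → ℝ)),
    ∃ g : Lp ℝ 2 (volume : Measure (Fin d → ℝ)),
      HasL2Sum volume D' (fun Q => component s Q f) g ∧ ‖g‖ ≤ ‖f‖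

/-- The complexity `κ = 1 + max(m, n)` of a Haar shift operator of complexity type `(m, n)`. -/
def complexity (m n : ℕ) : ℕ := 1 + max m n

/-- The measure `w(x) dx`. -/
noncomputable def weightMeasure {d : ℕ} (w : (Fin d → ℝ) → ℝ) : Measure (Fin d → ℝ) :=
  volume.withDensity fun x => ENNReal.ofReal (w x)

/-- The characteristic `[w]_{A₂} = sup_Q (w(Q)/|Q|) (σ(Q)/|Q|)`, `σ = w⁻¹`, over all cubes. -/
noncomputable def A2Const {d : ℕ} (w : (Fin d → ℝ) → ℝ) : ℝ≥0∞ :=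
  ⨆ Q : Cube d, (weightMeasure w Q.toSet / volume Q.toSet) *
    (weightMeasure (fun x => (w x)⁻¹) Q.toSet / volume Q.toSet)

/-- `w` is an `A₂` weight: measurable, positive almost everywhere, and `[w]_{A₂} < ∞`. -/
structure IsA2Weight {d : ℕ} (w : (Fin d → ℝ) → ℝ) : Prop where
  aemeasurable : AEMeasurable w
  pos : ∀ᵐ x, 0 < w x
  finite : A2Const w < ∞

end HaarShift

/-! By duality it suffices to bound the forms `∑ Q ∈ F, ∫ S_Q f · g` over finite `F ⊆ D`, uniformly
in `F`, by `κ [w]_{A₂}` times the norm of `f` in `L²(w)` and that of `g` in `L²(σ)`, where `σ =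
w⁻¹`.

Local estimate (`abs_sum_form_le_avg`). In a cube `Q₀`, stop at the maximal dyadic cubes on which
the mean of `|f|` or of `|g|` exceeds four times its mean over `Q₀`; they fill at most half of `Q₀`.
For the cubes of `F` in `Q₀` that lie in no stopping cube, replace `f` and `g` by their averages
`f'`, `g'` over a partition of `Q₀` that contains the stopping cubes. These are bounded by a
dimensional multiple of the means over `Q₀`, so the uniform `L²` bound for subfamilies of the shift
controls the form of `f'` and `g'`. The remainder `f - f'` has mean zero on each cube `P` of the
partition, so `S_Q` sees it only on the `P ⊆ Q` with `ℓ(P) > 2^{-n} ℓ(Q)`. Each `P` has at most `n`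
such ancestors, and likewise at most `m` for `g - g'`; hence the linear dependence on the
complexity. No weak-type estimate for the shift is needed.

Iteration (`ofReal_abs_sum_form_subset_le`). Repeat inside the stopping cubes. The portions of the
successive cubes outside their own stopping cubes are disjoint and have at least half the measure,
so the form is at most a constant times `κ ∫ Φ` whenever `Φ` dominates the product of the means of
`|f|` and `|g|` on each relevant cube.

Weights (`ofReal_abs_sum_form_le`). The product of means over `Q` equals `w(Q) σ(Q) / |Q|²` times
`(∫_Q |f|) / σ(Q)` times `(∫_Q |g|) / w(Q)`. Thus `Φ` can be `[w]_{A₂}` times a product of dyadic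
maximal functions, one with respect to `σ` and one with respect to `w`. Doob's inequality bounds
them with constants independent of the weight, so only one power of `[w]_{A₂}` appears. Uniform
bounds on finite partial sums give unconditional convergence in a Hilbert space. -/

namespace HaarShift

variable {d : ℕ}

/-! ### Cubes and the nesting structure of a dyadic grid -/

namespace Cube

lemma measurableSet_toSet (Q : Cube d) : MeasurableSet Q.toSet :=
  MeasurableSet.univ_pi fun _ => measurableSet_Ico

lemma corner_mem (Q : Cube d) : Q.corner ∈ Q.toSet := by
  intro i _
  exact ⟨le_rfl, by linarith [Q.side_pos]⟩

lemma volume_toSet (Q : Cube d) : volume Q.toSet = ENNReal.ofReal (Q.side ^ d) := by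
  rw [toSet, Real.volume_pi_Ico]
  simp [ENNReal.ofReal_pow Q.side_pos.le]

lemma vol_eq (Q : Cube d) : Q.vol = Q.side ^ d := by
  rw [vol, Measure.real, volume_toSet, ENNReal.toReal_ofReal (by have := Q.side_pos; positivity)]

lemma vol_pos (Q : Cube d) : 0 < Q.vol := by
  rw [vol_eq]; have := Q.side_pos; positivity

lemma ofReal_vol (Q : Cube d) : ENNReal.ofReal Q.vol = volume Q.toSet := by
  rw [vol_eq, volume_toSet]

lemma volume_ne_top (Q : Cube d) : volume Q.toSet ≠ ∞ := by
  rw [volume_toSet]; exact ENNReal.ofReal_ne_top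

lemma volume_ne_zero (Q : Cube d) : volume Q.toSet ≠ 0 := by
  rw [← ofReal_vol]; simpa using Q.vol_pos

lemma vol_mono {Q R : Cube d} (h : Q.toSet ⊆ R.toSet) : Q.vol ≤ R.vol :=
  measureReal_mono h R.volume_ne_top

lemma vol_eq_iff (hd : 0 < d) {Q R : Cube d} : Q.vol = R.vol ↔ Q.side = R.side := by
  rw [vol_eq, vol_eq]
  exact pow_left_inj₀ Q.side_pos.le R.side_pos.le hd.ne'

lemma side_mono (hd : 0 < d) {Q R : Cube d} (h : Q.toSet ⊆ R.toSet) : Q.side ≤ R.side := by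
  have := vol_mono h
  rw [vol_eq, vol_eq] at this
  exact (pow_le_pow_iff_left₀ Q.side_pos.le R.side_pos.le hd.ne').1 this

end Cube

namespace IsDyadicGrid

variable {D : Set (Cube d)} (hD : IsDyadicGrid D) (hd : 0 < d)
include hD hd

lemma eq_of_mem {Q R : Cube d} (hQ : Q ∈ D) (hR : R ∈ D) (h : Q.side = R.side)
    {x : Fin d → ℝ} (hxQ : x ∈ Q.toSet) (hxR : x ∈ R.toSet) : Q = R :=
  (hD.partition Q hQ x).unique ⟨hQ, rfl, hxQ⟩ ⟨hR, ((Cube.vol_eq_iff hd).2 h).symm, hxR⟩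

omit hD in
lemma side_child {Q R : Cube d} (h : R.vol = Q.vol / 2 ^ d) : R.side = Q.side / 2 := by
  rw [Cube.vol_eq, Cube.vol_eq, ← div_pow] at h
  exact (pow_left_inj₀ R.side_pos.le (by linarith [Q.side_pos]) hd.ne').1 h

lemma exists_descendant {Q : Cube d} (hQ : Q ∈ D) {x : Fin d → ℝ} (hx : x ∈ Q.toSet) (k : ℕ) :
    ∃ R ∈ D, R.toSet ⊆ Q.toSet ∧ R.side = Q.side / 2 ^ k ∧ x ∈ R.toSet := by
  induction k with
  | zero => exact ⟨Q, hQ, subset_rfl, by simp, hx⟩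
  | succ k ih =>
    obtain ⟨R, hR, hRQ, hs, hxR⟩ := ih
    obtain ⟨Ch, h1, -, h3, h4⟩ := hD.children R hR
    have := h4 ▸ hxR
    simp only [Set.mem_iUnion] at this
    obtain ⟨P, hP, hxP⟩ := this
    refine ⟨P, h1 P hP, ?_, ?_, hxP⟩
    · refine Set.Subset.trans ?_ hRQ
      rw [h4]
      exact Set.subset_biUnion_of_mem (u := fun P : Cube d => P.toSet) hP
    · rw [side_child hd (h3 P hP), hs, pow_succ, div_div]

omit hd in
lemma exists_side_eq {Q R : Cube d} (hQ : Q ∈ D) (hR : R ∈ D) (h : R.side ≤ Q.side) :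
    ∃ k : ℕ, R.side = Q.side / 2 ^ k := by
  obtain ⟨k, hk⟩ := hD.dyadic_scales Q hQ R hR
  have hk0 : k ≤ 0 := by
    by_contra! hlt
    have : (1 : ℝ) < 2 ^ k := one_lt_zpow₀ (by norm_num) hlt
    nlinarith [Q.side_pos]
  obtain ⟨n, rfl⟩ := Int.exists_eq_neg_ofNat hk0
  refine ⟨n, ?_⟩
  rw [hk, zpow_neg, zpow_natCast]
  field_simp

lemma subset_of_mem {Q R : Cube d} (hQ : Q ∈ D) (hR : R ∈ D) (h : R.side ≤ Q.side)
    {x : Fin d → ℝ} (hxQ : x ∈ Q.toSet) (hxR : x ∈ R.toSet) : R.toSet ⊆ Q.toSet := by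
  obtain ⟨k, hk⟩ := hD.exists_side_eq hQ hR h
  obtain ⟨P, hP, hPQ, hPs, hxP⟩ := hD.exists_descendant hd hQ hxQ k
  rwa [hD.eq_of_mem hd hR hP (hk.trans hPs.symm) hxR hxP]

lemma eq_of_subset {Q R : Cube d} (hQ : Q ∈ D) (hR : R ∈ D) (h : Q.toSet ⊆ R.toSet)
    (hs : R.side ≤ Q.side) : Q = R :=
  hD.eq_of_mem hd hQ hR (le_antisymm (Cube.side_mono hd h) hs) Q.corner_mem (h Q.corner_mem)

/-- A cube of the grid properly contained in another one has its parent contained there. -/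
lemma exists_parent {Q R : Cube d} (hQ : Q ∈ D) (hR : R ∈ D) (h : R.toSet ⊆ Q.toSet)
    (hne : R ≠ Q) :
    ∃ P ∈ D, R.toSet ⊆ P.toSet ∧ P.toSet ⊆ Q.toSet ∧ P.vol = 2 ^ d * R.vol ∧ R ≠ P := by
  obtain ⟨k, hk⟩ := hD.exists_side_eq hQ hR (Cube.side_mono hd h)
  obtain _ | k := k
  · exact absurd (hD.eq_of_subset hd hR hQ h (by simp [hk])) hne
  obtain ⟨P, hP, hPQ, hPs, hxP⟩ := hD.exists_descendant hd hQ (h R.corner_mem) k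
  have hs : P.side = 2 * R.side := by rw [hPs, hk, pow_succ]; field_simp
  refine ⟨P, hP, hD.subset_of_mem hd hP hR (by linarith [R.side_pos]) hxP R.corner_mem, hPQ, ?_, ?_⟩
  · rw [Cube.vol_eq, Cube.vol_eq, hs, mul_pow]
  · rintro rfl
    linarith [R.side_pos]

lemma finite_descendants {Q : Cube d} (hQ : Q ∈ D) (k : ℕ) :
    {R | R ∈ D ∧ R.toSet ⊆ Q.toSet ∧ R.side = Q.side / 2 ^ k}.Finite := by
  induction k generalizing Q with
  | zero =>
    refine (Set.finite_singleton Q).subset ?_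
    rintro R ⟨hR, hRQ, hs⟩
    exact hD.eq_of_subset hd hR hQ hRQ (by simp [hs])
  | succ k ih =>
    obtain ⟨Ch, h1, -, h3, h4⟩ := hD.children Q hQ
    refine (Set.Finite.biUnion Ch.finite_toSet (fun P hP => ih (h1 P hP))).subset ?_
    rintro R ⟨hR, hRQ, hs⟩
    have := h4 ▸ hRQ R.corner_mem
    simp only [Set.mem_iUnion] at this
    obtain ⟨P, hP, hxP⟩ := this
    have hPs := side_child hd (h3 P hP)
    have hs' : R.side = P.side / 2 ^ k := by rw [hs, hPs, pow_succ, mul_comm, div_div]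
    simp only [Set.mem_iUnion]
    refine ⟨P, hP, hR, hD.subset_of_mem hd (h1 P hP) hR ?_ hxP R.corner_mem, hs'⟩
    rw [hs']
    exact div_le_self P.side_pos.le (one_le_pow₀ (by norm_num))

lemma finite_subcubes {Q : Cube d} (hQ : Q ∈ D) {ε : ℝ} (hε : 0 < ε) :
    {R | R ∈ D ∧ R.toSet ⊆ Q.toSet ∧ ε ≤ R.side}.Finite := by
  obtain ⟨N, hN⟩ := pow_unbounded_of_one_lt (Q.side / ε) (one_lt_two)
  refine (Set.Finite.biUnion (Finset.range N).finite_toSet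
    (fun k _ => hD.finite_descendants hd hQ k)).subset ?_
  rintro R ⟨hR, hRQ, hs⟩
  obtain ⟨k, hk⟩ := hD.exists_side_eq hQ hR (Cube.side_mono hd hRQ)
  simp only [Set.mem_iUnion]
  refine ⟨k, ?_, hR, hRQ, hk⟩
  simp only [Finset.coe_range, Set.mem_Iio]
  have h2 : (2 : ℝ) ^ k < 2 ^ N := by
    refine lt_of_le_of_lt ?_ hN
    rw [le_div_iff₀ hε]
    rw [hk, le_div_iff₀ (by positivity)] at hs
    linarith
  exact (pow_lt_pow_iff_right₀ (by norm_num)).1 h2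

/-- The maximal cubes of a finite subfamily of a grid are disjoint and have the same union. -/
lemma exists_maximal (G : Finset (Cube d)) (hG : ∀ Q ∈ G, Q ∈ D) :
    ∃ G' ⊆ G, (G' : Set (Cube d)).PairwiseDisjoint Cube.toSet ∧
      (∀ Q ∈ G, ∃ R ∈ G', Q.toSet ⊆ R.toSet) ∧
      ∀ Q ∈ G', ∀ R ∈ G, Q.toSet ⊆ R.toSet → R = Q := by
  classical
  refine ⟨G.filter fun Q => ∀ R ∈ G, Q.toSet ⊆ R.toSet → R = Q, Finset.filter_subset _ _,
    ?_, ?_, fun Q hQ => (Finset.mem_filter.1 hQ).2⟩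
  · intro Q hQ R hR hne
    simp only [Finset.coe_filter, Set.mem_ofPred_eq] at hQ hR
    refine Set.disjoint_left.2 fun x hxQ hxR => hne ?_
    rcases le_total Q.side R.side with h | h
    · exact (hQ.2 R hR.1 (hD.subset_of_mem hd (hG R hR.1) (hG Q hQ.1) h hxR hxQ)).symm
    · exact hR.2 Q hQ.1 (hD.subset_of_mem hd (hG Q hQ.1) (hG R hR.1) h hxQ hxR)
  · intro Q hQ
    obtain ⟨R, hR, hmax⟩ := (G.filter fun R => Q.toSet ⊆ R.toSet).exists_max_image Cube.side
      ⟨Q, by simp [hQ]⟩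
    simp only [Finset.mem_filter] at hR hmax
    refine ⟨R, ?_, hR.2⟩
    simp only [Finset.mem_filter]
    refine ⟨hR.1, fun P hP hRP => ?_⟩
    exact (hD.eq_of_subset hd (hG R hR.1) (hG P hP) hRP (hmax P ⟨hP, hR.2.trans hRP⟩)).symm

end IsDyadicGrid
-- Measurability and size of the components
-- Such a function takes finitely many values, one on each descendant of generation `k` and zero
-- elsewhere. This supplies the measurability of kernels and components, which the definition of a
-- shift does not postulate.
lemma IsDyadicGrid.measurable_of_piecewise {D : Set (Cube d)} (hD : IsDyadicGrid D) (hd : 0 < d)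
    {Q : Cube d} (hQ : Q ∈ D) (k : ℕ) {u : (Fin d → ℝ) → ℝ} (h0 : ∀ x ∉ Q.toSet, u x = 0)
    (hc : ∀ R ∈ D, R.toSet ⊆ Q.toSet → R.side ≤ Q.side / 2 ^ k →
      ∀ x ∈ R.toSet, ∀ x' ∈ R.toSet, u x = u x') : Measurable u := by
  intro A _
  have hfin := hD.finite_descendants hd hQ k
  have key : ∀ x ∈ Q.toSet, ∃ R, (R ∈ D ∧ R.toSet ⊆ Q.toSet ∧ R.side = Q.side / 2 ^ k) ∧
      x ∈ R.toSet ∧ u x = u R.corner := by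
    intro x hx
    obtain ⟨R, hR, hRQ, hs, hxR⟩ := hD.exists_descendant hd hQ hx k
    exact ⟨R, ⟨hR, hRQ, hs⟩, hxR, hc R hR hRQ hs.le x hxR _ R.corner_mem⟩
  have : u ⁻¹' A = (⋃ R ∈ {R | (R ∈ D ∧ R.toSet ⊆ Q.toSet ∧ R.side = Q.side / 2 ^ k) ∧
      u R.corner ∈ A}, R.toSet) ∪ (Q.toSetᶜ ∩ {_x | (0 : ℝ) ∈ A}) := by
    ext x
    simp only [Set.mem_preimage, Set.mem_union, Set.mem_iUnion, Set.mem_inter_iff,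
      Set.mem_compl_iff]
    constructor
    · intro hx
      by_cases hxQ : x ∈ Q.toSet
      · obtain ⟨R, hR, hxR, hu⟩ := key x hxQ
        exact Or.inl ⟨R, ⟨hR, hu ▸ hx⟩, hxR⟩
      · exact Or.inr ⟨hxQ, by rw [h0 x hxQ] at hx; exact hx⟩
    · rintro (⟨R, ⟨hR, hu⟩, hxR⟩ | ⟨hxQ, hx⟩)
      · rwa [hc R hR.1 hR.2.1 hR.2.2.le x hxR _ R.corner_mem]
      · rw [h0 x hxQ]; exact hx
  rw [this]
  refine MeasurableSet.union (Set.Finite.measurableSet_biUnion (hfin.subset fun R hR => hR.1)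
    fun R _ => R.measurableSet_toSet) (Q.measurableSet_toSet.compl.inter (MeasurableSet.const _))

namespace IsHaarShift

variable {D : Set (Cube d)} {m n : ℕ} {s : Cube d → (Fin d → ℝ) → (Fin d → ℝ) → ℝ}
  {S : Lp ℝ 2 (volume : Measure (Fin d → ℝ)) →ₗ[ℝ] Lp ℝ 2 (volume : Measure (Fin d → ℝ))}
  (h : IsHaarShift D m n s S) (hd : 0 < d)
include h hd

lemma kernel_eq_right {Q : Cube d} (hQ : Q ∈ D) (x : Fin d → ℝ) {T : Cube d} (hT : T ∈ D)
    (hTQ : T.toSet ⊆ Q.toSet) (hs : T.side ≤ Q.side / 2 ^ n) {y y' : Fin d → ℝ}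
    (hy : y ∈ T.toSet) (hy' : y' ∈ T.toSet) : s Q x y = s Q x y' := by
  by_cases hx : x ∈ Q.toSet
  · obtain ⟨R, hR, hRQ, hRs, hxR⟩ := h.grid.exists_descendant hd hQ hx m
    exact h.const_on Q hQ R hR T hT hRQ hTQ hRs.le hs x hxR x hxR y hy y' hy'
  · have : ∀ z, s Q x z = 0 := fun z => by
      by_contra hne
      exact hx (h.support Q hQ x z hne).1
    rw [this, this]

lemma kernel_eq_left {Q : Cube d} (hQ : Q ∈ D) (y : Fin d → ℝ) {R : Cube d} (hR : R ∈ D)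
    (hRQ : R.toSet ⊆ Q.toSet) (hs : R.side ≤ Q.side / 2 ^ m) {x x' : Fin d → ℝ}
    (hx : x ∈ R.toSet) (hx' : x' ∈ R.toSet) : s Q x y = s Q x' y := by
  by_cases hy : y ∈ Q.toSet
  · obtain ⟨T, hT, hTQ, hTs, hyT⟩ := h.grid.exists_descendant hd hQ hy n
    exact h.const_on Q hQ R hR T hT hRQ hTQ hs hTs.le x hx x' hx' y hyT y hyT
  · have : ∀ z, s Q z y = 0 := fun z => by
      by_contra hne
      exact hy (h.support Q hQ z y hne).2
    rw [this, this]

lemma measurable_kernel {Q : Cube d} (hQ : Q ∈ D) (x : Fin d → ℝ) : Measurable (s Q x) := by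
  refine h.grid.measurable_of_piecewise hd hQ n (fun y hy => ?_) fun T hT hTQ hs y hy y' hy' =>
    h.kernel_eq_right hd hQ x hT hTQ hs hy hy'
  by_contra hne
  exact hy (h.support Q hQ x y hne).2

omit hd in
lemma component_eq_zero_of_notMem {Q : Cube d} (hQ : Q ∈ D) (f : (Fin d → ℝ) → ℝ) {x : Fin d → ℝ}
    (hx : x ∉ Q.toSet) : component s Q f x = 0 := by
  have : ∀ z, s Q x z = 0 := fun z => by
    by_contra hne
    exact hx (h.support Q hQ x z hne).1
  simp [component, this]

lemma component_eq {Q : Cube d} (hQ : Q ∈ D) (f : (Fin d → ℝ) → ℝ) {R : Cube d} (hR : R ∈ D)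
    (hRQ : R.toSet ⊆ Q.toSet) (hs : R.side ≤ Q.side / 2 ^ m) {x x' : Fin d → ℝ}
    (hx : x ∈ R.toSet) (hx' : x' ∈ R.toSet) : component s Q f x = component s Q f x' := by
  simp only [component]
  congr 1
  ext y
  rw [h.kernel_eq_left hd hQ y hR hRQ hs hx hx']

lemma measurable_component {Q : Cube d} (hQ : Q ∈ D) (f : (Fin d → ℝ) → ℝ) :
    Measurable (component s Q f) :=
  h.grid.measurable_of_piecewise hd hQ m (fun _ hx => h.component_eq_zero_of_notMem hQ f hx)
    fun _ hR hRQ hs _ hx _ hx' => h.component_eq hd hQ f hR hRQ hs hx hx'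

omit hd in
lemma abs_component_le {Q : Cube d} (hQ : Q ∈ D) {f : (Fin d → ℝ) → ℝ}
    (hf : IntegrableOn f Q.toSet) (x : Fin d → ℝ) :
    |component s Q f x| ≤ (∫ y in Q.toSet, |f y|) / Q.vol := by
  rw [div_eq_inv_mul, ← integral_const_mul, component]
  refine (Real.norm_eq_abs _).symm.trans_le <| norm_integral_le_of_norm_le
    (hf.abs.const_mul _) (ae_of_all _ fun y => ?_)
  rw [Real.norm_eq_abs, abs_mul]
  gcongr
  simpa using h.bound Q hQ x y

lemma integrableOn_kernel_mul {Q : Cube d} (hQ : Q ∈ D) {f : (Fin d → ℝ) → ℝ}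
    (hf : IntegrableOn f Q.toSet) (x : Fin d → ℝ) :
    IntegrableOn (fun y => s Q x y * f y) Q.toSet :=
  Integrable.bdd_mul hf (h.measurable_kernel hd hQ x).aestronglyMeasurable
    (ae_of_all _ fun y => by simpa using h.bound Q hQ x y)

lemma component_sub {Q : Cube d} (hQ : Q ∈ D) {f g : (Fin d → ℝ) → ℝ}
    (hf : IntegrableOn f Q.toSet) (hg : IntegrableOn g Q.toSet) (x : Fin d → ℝ) :
    component s Q (fun y => f y - g y) x = component s Q f x - component s Q g x := by
  simp only [component, mul_sub]
  exact integral_sub (μ := volume.restrict Q.toSet)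
    (h.integrableOn_kernel_mul hd hQ hf x) (h.integrableOn_kernel_mul hd hQ hg x)

end IsHaarShift

/-! ### The bilinear form: cancellation and the `L²` bound -/

/-- The bilinear form `∫_Q S_Q f · g`. -/
noncomputable def form (s : Cube d → (Fin d → ℝ) → (Fin d → ℝ) → ℝ) (Q : Cube d)
    (f g : (Fin d → ℝ) → ℝ) : ℝ :=
  ∫ x in Q.toSet, component s Q f x * g x

namespace IsHaarShift

variable {D : Set (Cube d)} {m n : ℕ} {s : Cube d → (Fin d → ℝ) → (Fin d → ℝ) → ℝ}
  {S : Lp ℝ 2 (volume : Measure (Fin d → ℝ)) →ₗ[ℝ] Lp ℝ 2 (volume : Measure (Fin d → ℝ))}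
  (h : IsHaarShift D m n s S) (hd : 0 < d)
include h hd

lemma integrableOn_component_mul {Q : Cube d} (hQ : Q ∈ D) {f g : (Fin d → ℝ) → ℝ}
    (hf : IntegrableOn f Q.toSet) (hg : IntegrableOn g Q.toSet) :
    IntegrableOn (fun x => component s Q f x * g x) Q.toSet :=
  Integrable.bdd_mul hg (h.measurable_component hd hQ f).aestronglyMeasurable
    (ae_of_all _ fun x => by simpa using h.abs_component_le hQ hf x)

lemma form_sub_left {Q : Cube d} (hQ : Q ∈ D) {f f' g : (Fin d → ℝ) → ℝ}
    (hf : IntegrableOn f Q.toSet) (hf' : IntegrableOn f' Q.toSet) (hg : IntegrableOn g Q.toSet) :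
    form s Q (fun y => f y - f' y) g = form s Q f g - form s Q f' g := by
  simp only [form, h.component_sub hd hQ hf hf', sub_mul]
  exact integral_sub (h.integrableOn_component_mul hd hQ hf hg)
    (h.integrableOn_component_mul hd hQ hf' hg)

lemma form_sub_right {Q : Cube d} (hQ : Q ∈ D) {f g g' : (Fin d → ℝ) → ℝ}
    (hf : IntegrableOn f Q.toSet) (hg : IntegrableOn g Q.toSet) (hg' : IntegrableOn g' Q.toSet) :
    form s Q f (fun y => g y - g' y) = form s Q f g - form s Q f g' := by
  simp only [form, mul_sub]
  exact integral_sub (h.integrableOn_component_mul hd hQ hf hg)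
    (h.integrableOn_component_mul hd hQ hf hg')

/-- If `f` has mean zero on the cubes of a partition of `Q`, then only the large cubes of the
partition contribute to the form. -/
lemma abs_form_le_of_mean_zero_left {Q : Cube d} (hQ : Q ∈ D) {f g : (Fin d → ℝ) → ℝ}
    (hf : IntegrableOn f Q.toSet) (hg : IntegrableOn g Q.toSet) (J : Finset (Cube d))
    (hP : ∀ P ∈ J, P ∈ D ∧ P.toSet ⊆ Q.toSet)
    (hdisj : (J : Set (Cube d)).PairwiseDisjoint Cube.toSet)
    (hcov : Q.toSet ⊆ ⋃ P ∈ J, P.toSet) (h0 : ∀ P ∈ J, ∫ y in P.toSet, f y = 0) :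
    |form s Q f g| ≤ (∑ P ∈ J with Q.side / 2 ^ n < P.side, ∫ y in P.toSet, |f y|) *
      ((∫ x in Q.toSet, |g x|) / Q.vol) := by
  have hQe : Q.toSet = ⋃ P ∈ J, P.toSet :=
    hcov.antisymm (Set.iUnion₂_subset fun P hp => (hP P hp).2)
  have hfP : ∀ P ∈ J, IntegrableOn f P.toSet := fun P hp => hf.mono_set (hP P hp).2
  have hc : ∀ x, |component s Q f x| ≤
      (∑ P ∈ J with Q.side / 2 ^ n < P.side, ∫ y in P.toSet, |f y|) / Q.vol := by
    intro x
    have h1 : component s Q f x = ∑ P ∈ J, ∫ y in P.toSet, s Q x y * f y := by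
      rw [component]
      conv_lhs => rw [hQe]
      exact integral_biUnion_finset J (fun P _ => P.measurableSet_toSet) hdisj
        fun P hp => (h.integrableOn_kernel_mul hd hQ hf x).mono_set (hP P hp).2
    rw [h1, Finset.sum_div, ← Finset.sum_filter_add_sum_filter_not J
      (fun P => Q.side / 2 ^ n < P.side)]
    -- On a small `P` the kernel is constant in `y`, so the vanishing mean of `f` annihilates the
    -- integral.
    have h2 : ∑ P ∈ J with ¬ Q.side / 2 ^ n < P.side, ∫ y in P.toSet, s Q x y * f y = 0 := by
      refine Finset.sum_eq_zero fun P hp => ?_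
      rw [Finset.mem_filter, not_lt] at hp
      rw [setIntegral_congr_fun (g := fun y => s Q x P.corner * f y) P.measurableSet_toSet,
        integral_const_mul, h0 P hp.1, mul_zero]
      intro y hy
      simp only [h.kernel_eq_right hd hQ x (hP P hp.1).1 (hP P hp.1).2 hp.2 hy P.corner_mem]
    rw [h2, add_zero]
    refine (Finset.abs_sum_le_sum_abs _ _).trans (Finset.sum_le_sum fun P hp => ?_)
    rw [div_eq_inv_mul, ← integral_const_mul]
    refine (Real.norm_eq_abs _).symm.trans_le <| norm_integral_le_of_norm_le
      ((hfP P (Finset.mem_filter.1 hp).1).abs.const_mul _)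
      (ae_of_all _ fun y => ?_)
    rw [Real.norm_eq_abs, abs_mul]
    gcongr
    simpa using h.bound Q hQ x y
  rw [mul_div_left_comm, mul_comm, ← integral_const_mul]
  refine (Real.norm_eq_abs _).symm.trans_le <| norm_integral_le_of_norm_le
    (hg.abs.const_mul _) (ae_of_all _ fun x => ?_)
  rw [Real.norm_eq_abs, abs_mul]
  gcongr
  exact hc x

/-- Here the cancellation comes from the output variable: `S_Q f` is constant on grid subcubes of
side at most `2^{-m} ℓ(Q)`. -/
lemma abs_form_le_of_mean_zero_right {Q : Cube d} (hQ : Q ∈ D) {f g : (Fin d → ℝ) → ℝ}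
    (hf : IntegrableOn f Q.toSet) (hg : IntegrableOn g Q.toSet) (J : Finset (Cube d))
    (hP : ∀ P ∈ J, P ∈ D ∧ P.toSet ⊆ Q.toSet)
    (hdisj : (J : Set (Cube d)).PairwiseDisjoint Cube.toSet)
    (hcov : Q.toSet ⊆ ⋃ P ∈ J, P.toSet) (h0 : ∀ P ∈ J, ∫ y in P.toSet, g y = 0) :
    |form s Q f g| ≤ (∑ P ∈ J with Q.side / 2 ^ m < P.side, ∫ y in P.toSet, |g y|) *
      ((∫ x in Q.toSet, |f x|) / Q.vol) := by
  have hQe : Q.toSet = ⋃ P ∈ J, P.toSet :=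
    hcov.antisymm (Set.iUnion₂_subset fun P hp => (hP P hp).2)
  have h1 : form s Q f g = ∑ P ∈ J, ∫ x in P.toSet, component s Q f x * g x := by
    rw [form]
    conv_lhs => rw [hQe]
    exact integral_biUnion_finset J (fun P _ => P.measurableSet_toSet) hdisj
      fun P hp => (h.integrableOn_component_mul hd hQ hf hg).mono_set (hP P hp).2
  rw [h1, Finset.sum_mul, ← Finset.sum_filter_add_sum_filter_not J
    (fun P => Q.side / 2 ^ m < P.side)]
  have h2 : ∑ P ∈ J with ¬ Q.side / 2 ^ m < P.side,
      ∫ x in P.toSet, component s Q f x * g x = 0 := by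
    refine Finset.sum_eq_zero fun P hp => ?_
    rw [Finset.mem_filter, not_lt] at hp
    rw [setIntegral_congr_fun (g := fun x => component s Q f P.corner * g x) P.measurableSet_toSet,
      integral_const_mul, h0 P hp.1, mul_zero]
    intro x hx
    simp only [h.component_eq hd hQ f (hP P hp.1).1 (hP P hp.1).2 hp.2 hx P.corner_mem]
  rw [h2, add_zero]
  refine (Finset.abs_sum_le_sum_abs _ _).trans (Finset.sum_le_sum fun P hp => ?_)
  rw [mul_comm, ← integral_const_mul]
  refine (Real.norm_eq_abs _).symm.trans_le <| norm_integral_le_of_norm_le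
    ((hg.mono_set (hP P (Finset.mem_filter.1 hp).1).2).abs.const_mul _) (ae_of_all _ fun x => ?_)
  rw [Real.norm_eq_abs, abs_mul]
  gcongr
  exact h.abs_component_le hQ hf x

/-- The bound postulated for subfamilies concerns a limit `g`; for a finite subfamily that limit is
the sum itself, almost everywhere. -/
lemma eLpNorm_sum_component_le (F : Finset (Cube d)) (hF : ∀ Q ∈ F, Q ∈ D)
    (f : Lp ℝ 2 (volume : Measure (Fin d → ℝ))) :
    eLpNorm (fun x => ∑ Q ∈ F, component s Q f x) 2 volume ≤ eLpNorm f 2 volume := by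
  classical
  obtain ⟨g, hg, hle⟩ := h.unconditional (F : Set (Cube d)) (fun Q hQ => hF Q hQ) f
  -- The finite subsets of a finite set have a largest element, so the net is evaluated at the full
  -- set and the error there is exactly zero.
  have htop : (atTop : Filter (Finset (F : Set (Cube d)))) = pure Finset.univ := by
    rw [← Finset.top_eq_univ]; exact OrderTop.atTop_eq _
  rw [HasL2Sum, htop, tendsto_pure_left] at hg
  have h0 : eLpNorm (fun x => g x - ∑ Q ∈ F, component s Q f x) 2 volume = 0 := by
    have : ∀ x, ∑ Q ∈ F, component s Q f x =
        ∑ Q : (F : Set (Cube d)), component s Q f x := fun x =>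
      (Finset.sum_coe_sort F fun Q => component s Q f x).symm
    simp only [this]
    by_contra hne
    have := hg (Set.Iio (eLpNorm (fun x => g x - ∑ Q : (F : Set (Cube d)), component s Q f x) 2
      volume)) (Iio_mem_nhds (pos_iff_ne_zero.2 hne))
    exact lt_irrefl _ (Set.mem_Iio.1 this)
  have h0 := (eLpNorm_eq_zero_iff ((Lp.aestronglyMeasurable g).sub
    (Finset.measurable_fun_sum F fun Q hQ =>
      h.measurable_component hd (hF Q hQ) f).aestronglyMeasurable) two_ne_zero).1 h0
  have hae : (fun x => ∑ Q ∈ F, component s Q f x) =ᵐ[volume] g := by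
    filter_upwards [h0] with x hx
    exact (sub_eq_zero.1 hx).symm
  rw [eLpNorm_congr_ae hae]
  rw [Lp.norm_def, Lp.norm_def] at hle
  exact (ENNReal.toReal_le_toReal (Lp.eLpNorm_ne_top g) (Lp.eLpNorm_ne_top f)).1 hle

/-- The `L²` bound for the bilinear form, in the case of bounded functions on a cube. -/
lemma abs_sum_form_le_of_bounded (F : Finset (Cube d)) {Q₀ : Cube d}
    (hF : ∀ Q ∈ F, Q ∈ D ∧ Q.toSet ⊆ Q₀.toSet) {f g : (Fin d → ℝ) → ℝ} {a b : ℝ}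
    (hf : Measurable f) (hg : Measurable g) (ha : ∀ x, |f x| ≤ Q₀.toSet.indicator (fun _ => a) x)
    (hb : ∀ x, |g x| ≤ Q₀.toSet.indicator (fun _ => b) x) (ha0 : 0 ≤ a) (hb0 : 0 ≤ b) :
    |∑ Q ∈ F, form s Q f g| ≤ a * b * Q₀.vol := by
  have hmem : ∀ {u : (Fin d → ℝ) → ℝ} {c : ℝ}, Measurable u → 0 ≤ c →
      (∀ x, |u x| ≤ Q₀.toSet.indicator (fun _ => c) x) →
      eLpNorm u 2 volume ≤ ENNReal.ofReal (c * √Q₀.vol) := by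
    intro u c hu hc0 hc
    calc eLpNorm u 2 volume ≤ eLpNorm (Q₀.toSet.indicator fun _ => c) 2 volume :=
          eLpNorm_mono_real hc
      _ = ENNReal.ofReal (c * √Q₀.vol) := by
          rw [eLpNorm_indicator_const Q₀.measurableSet_toSet two_ne_zero ENNReal.ofNat_ne_top,
            ← Cube.ofReal_vol, Real.enorm_eq_ofReal_abs, abs_of_nonneg hc0,
            ENNReal.ofReal_rpow_of_pos Q₀.vol_pos, ← ENNReal.ofReal_mul hc0, Real.sqrt_eq_rpow]
          norm_num
  have hfL : MemLp f 2 volume :=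
    ⟨hf.aestronglyMeasurable, (hmem hf ha0 ha).trans_lt ENNReal.ofReal_lt_top⟩
  have hgL : MemLp g 2 volume :=
    ⟨hg.aestronglyMeasurable, (hmem hg hb0 hb).trans_lt ENNReal.ofReal_lt_top⟩
  set v : (Fin d → ℝ) → ℝ := fun x => ∑ Q ∈ F, component s Q f x with hv
  have hvm : Measurable v := Finset.measurable_fun_sum F fun Q hQ =>
    h.measurable_component hd (hF Q hQ).1 f
  have hcomp : ∀ Q, component s Q (hfL.toLp f) = component s Q f := fun Q => by
    ext x
    refine integral_congr_ae (ae_restrict_of_ae ?_)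
    filter_upwards [hfL.coeFn_toLp] with y hy
    rw [hy]
  have hvle : eLpNorm v 2 volume ≤ ENNReal.ofReal (a * √Q₀.vol) := by
    have := h.eLpNorm_sum_component_le hd F (fun Q hQ => (hF Q hQ).1) (hfL.toLp f)
    simp only [hcomp] at this
    exact this.trans ((eLpNorm_congr_ae hfL.coeFn_toLp).le.trans (hmem hf ha0 ha))
  have hvL : MemLp v 2 volume := ⟨hvm.aestronglyMeasurable, hvle.trans_lt ENNReal.ofReal_lt_top⟩
  have hint : ∀ Q ∈ F, Integrable (fun x => component s Q f x * g x) volume := fun Q hQ => by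
    have hcL : Integrable g volume := by
      refine Integrable.mono' (g := Q₀.toSet.indicator fun _ => b) ?_ hg.aestronglyMeasurable
        (ae_of_all _ hb)
      exact (integrable_indicator_iff Q₀.measurableSet_toSet).2
        (integrableOn_const Q₀.volume_ne_top)
    have hfI : IntegrableOn f Q.toSet := by
      refine Integrable.mono' (g := Q₀.toSet.indicator fun _ => a) ?_ hf.aestronglyMeasurable
        (ae_of_all _ ha)
      exact ((integrable_indicator_iff Q₀.measurableSet_toSet).2
        (integrableOn_const Q₀.volume_ne_top)).integrableOn
    exact Integrable.bdd_mul hcL (h.measurable_component hd (hF Q hQ).1 f).aestronglyMeasurable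
      (ae_of_all _ fun x => by simpa using h.abs_component_le (hF Q hQ).1 hfI x)
  have hsum : ∑ Q ∈ F, form s Q f g = ∫ x, v x * g x := by
    simp only [hv, Finset.sum_mul]
    rw [integral_finsetSum F hint]
    refine Finset.sum_congr rfl fun Q hQ => ?_
    rw [form]
    refine setIntegral_eq_integral_of_forall_compl_eq_zero fun x hx => ?_
    rw [h.component_eq_zero_of_notMem (hF Q hQ).1 f hx, zero_mul]
  have hinner : ∫ x, v x * g x = inner ℝ (hgL.toLp g) (hvL.toLp v) := by
    rw [L2.inner_def]
    refine integral_congr_ae ?_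
    filter_upwards [hvL.coeFn_toLp, hgL.coeFn_toLp] with x h1 h2
    simp [h1, h2]
  rw [hsum, hinner]
  refine (abs_real_inner_le_norm _ _).trans ?_
  rw [Lp.norm_toLp, Lp.norm_toLp]
  have e1 := ENNReal.toReal_le_of_le_ofReal (by positivity) hvle
  have e2 := ENNReal.toReal_le_of_le_ofReal (by positivity) (hmem hg hb0 hb)
  calc _ ≤ (b * √Q₀.vol) * (a * √Q₀.vol) := by gcongr
    _ = a * b * Q₀.vol := by
      linear_combination a * b * Real.mul_self_sqrt Q₀.vol_pos.le

end IsHaarShift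
-- Averages and Calderón–Zygmund stopping cubes
/-- The average of `|f|` over a cube. -/
noncomputable def avg (f : (Fin d → ℝ) → ℝ) (Q : Cube d) : ℝ := (∫ x in Q.toSet, |f x|) / Q.vol

lemma avg_nonneg (f : (Fin d → ℝ) → ℝ) (Q : Cube d) : 0 ≤ avg f Q :=
  div_nonneg (integral_nonneg fun _ => abs_nonneg _) Q.vol_pos.le

lemma avg_mul_vol (f : (Fin d → ℝ) → ℝ) (Q : Cube d) :
    avg f Q * Q.vol = ∫ x in Q.toSet, |f x| :=
  div_mul_cancel₀ _ Q.vol_pos.ne'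

lemma sum_setIntegral_abs_le {f : (Fin d → ℝ) → ℝ} {A : Set (Fin d → ℝ)} (hf : IntegrableOn f A)
    {J : Finset (Cube d)} (hJ : ∀ P ∈ J, P.toSet ⊆ A)
    (hdisj : (J : Set (Cube d)).PairwiseDisjoint Cube.toSet) :
    ∑ P ∈ J, ∫ x in P.toSet, |f x| ≤ ∫ x in A, |f x| := by
  rw [← integral_biUnion_finset J (fun P _ => P.measurableSet_toSet) hdisj
    fun P hP => (hf.mono_set (hJ P hP)).abs]
  exact setIntegral_mono_set hf.abs (ae_of_all _ fun _ => abs_nonneg _)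
    (Set.iUnion₂_subset hJ).eventuallyLE

lemma setIntegral_abs_mono {f : (Fin d → ℝ) → ℝ} {A B : Set (Fin d → ℝ)} (hf : IntegrableOn f B)
    (h : A ⊆ B) : ∫ x in A, |f x| ≤ ∫ x in B, |f x| :=
  setIntegral_mono_set hf.abs (ae_of_all _ fun _ => abs_nonneg _) h.eventuallyLE

/-- Chebyshev's inequality over disjoint cubes. The strict inequality matters when `f` has zero mean
modulus on `Q`: then `J` must be empty. -/
lemma sum_vol_le_of_avg_lt {f : (Fin d → ℝ) → ℝ} {Q : Cube d} (hf : IntegrableOn f Q.toSet)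
    {J : Finset (Cube d)} (hJ : ∀ P ∈ J, P.toSet ⊆ Q.toSet)
    (hdisj : (J : Set (Cube d)).PairwiseDisjoint Cube.toSet)
    (h : ∀ P ∈ J, 4 * avg f Q < avg f P) : ∑ P ∈ J, P.vol ≤ Q.vol / 4 := by
  have h1 : 4 * avg f Q * ∑ P ∈ J, P.vol ≤ avg f Q * Q.vol := by
    rw [avg_mul_vol, Finset.mul_sum]
    refine le_trans (Finset.sum_le_sum fun P hP => ?_) (sum_setIntegral_abs_le hf hJ hdisj)
    rw [← avg_mul_vol]
    exact mul_le_mul_of_nonneg_right (h P hP).le P.vol_pos.le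
  rcases (avg_nonneg f Q).eq_or_lt with h0 | h0
  · rcases J.eq_empty_or_nonempty with rfl | ⟨P, hP⟩
    · simpa using div_nonneg Q.vol_pos.le zero_le_four
    · have h2 := h P hP
      have h3 := avg_mul_vol f P
      have h4 := setIntegral_abs_mono hf (hJ P hP)
      rw [← avg_mul_vol f Q, ← h0, zero_mul, ← h3] at h4
      rw [← h0, mul_zero] at h2
      exact absurd (mul_pos h2 P.vol_pos) h4.not_gt
  · nlinarith

/-- The Calderón–Zygmund stopping cubes of a pair of functions: `J` partitions `Q₀`, and the
cubes of `J` outside of `St` have side `Q₀.side / 2 ^ N`. -/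
structure IsStopping (D : Set (Cube d)) (Q₀ : Cube d) (N : ℕ) (f g : (Fin d → ℝ) → ℝ)
    (J St : Finset (Cube d)) : Prop where
  stopping_subset : St ⊆ J
  mem : ∀ P ∈ J, P ∈ D ∧ P.toSet ⊆ Q₀.toSet
  disjoint : (J : Set (Cube d)).PairwiseDisjoint Cube.toSet
  cover : Q₀.toSet ⊆ ⋃ P ∈ J, P.toSet
  side_eq : ∀ P ∈ J, P ∉ St → P.side = Q₀.side / 2 ^ N
  avg_left : ∀ P ∈ J, avg f P ≤ 4 * 2 ^ d * avg f Q₀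
  avg_right : ∀ P ∈ J, avg g P ≤ 4 * 2 ^ d * avg g Q₀
  good_left : ∀ Q ∈ D, Q.toSet ⊆ Q₀.toSet → Q₀.side / 2 ^ N ≤ Q.side →
    (∀ P ∈ St, ¬ Q.toSet ⊆ P.toSet) → avg f Q ≤ 4 * avg f Q₀
  good_right : ∀ Q ∈ D, Q.toSet ⊆ Q₀.toSet → Q₀.side / 2 ^ N ≤ Q.side →
    (∀ P ∈ St, ¬ Q.toSet ⊆ P.toSet) → avg g Q ≤ 4 * avg g Q₀
  sum_vol : ∑ P ∈ St, P.vol ≤ Q₀.vol / 2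

lemma avg_le_of_subset {f : (Fin d → ℝ) → ℝ} {P R : Cube d} (hf : IntegrableOn f R.toSet)
    (h : P.toSet ⊆ R.toSet) (hv : R.vol = 2 ^ d * P.vol) : avg f P ≤ 2 ^ d * avg f R := by
  have h1 := setIntegral_abs_mono hf h
  rw [avg, avg, hv, ← mul_div_assoc, mul_div_mul_left _ _ (by positivity)]
  exact div_le_div_of_nonneg_right h1 P.vol_pos.le

/-- Maximality makes the parent of a stopping cube satisfy the threshold `4`, and passing to a child
loses at most `2 ^ d`. Each of `f` and `g` selects cubes filling at most a quarter of `Q₀`, so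
together at most half. Truncation at generation `N` keeps all families finite. -/
lemma IsDyadicGrid.exists_isStopping {D : Set (Cube d)} (hD : IsDyadicGrid D) (hd : 0 < d)
    {Q₀ : Cube d} (hQ₀ : Q₀ ∈ D) (N : ℕ) {f g : (Fin d → ℝ) → ℝ} (hf : IntegrableOn f Q₀.toSet)
    (hg : IntegrableOn g Q₀.toSet) : ∃ J St, IsStopping D Q₀ N f g J St := by
  classical
  have hε : 0 < Q₀.side / 2 ^ N := by have := Q₀.side_pos; positivity
  set T := (hD.finite_subcubes hd hQ₀ hε).toFinset with hT
  have hTm : ∀ P, P ∈ T ↔ P ∈ D ∧ P.toSet ⊆ Q₀.toSet ∧ Q₀.side / 2 ^ N ≤ P.side := fun P => by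
    rw [hT, Set.Finite.mem_toFinset]; rfl
  set A := T.filter fun P => 4 * avg f Q₀ < avg f P ∨ 4 * avg g Q₀ < avg g P with hA
  obtain ⟨St, hStA, hStd, hStc, hStm⟩ := hD.exists_maximal hd A
    fun Q hQ => ((hTm Q).1 (Finset.mem_filter.1 hQ).1).1
  have hStT : ∀ P ∈ St, P ∈ D ∧ P.toSet ⊆ Q₀.toSet ∧ Q₀.side / 2 ^ N ≤ P.side :=
    fun P hP => (hTm P).1 (Finset.mem_filter.1 (hStA hP)).1
  -- The cubes of generation `N` missed by the stopping cubes complete `St` to a partition of `Q₀`.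
  set B := T.filter fun P => P.side = Q₀.side / 2 ^ N ∧ ∀ R ∈ St, ¬ P.toSet ⊆ R.toSet with hB
  have good : ∀ Q ∈ D, Q.toSet ⊆ Q₀.toSet → Q₀.side / 2 ^ N ≤ Q.side →
      (∀ P ∈ St, ¬ Q.toSet ⊆ P.toSet) → avg f Q ≤ 4 * avg f Q₀ ∧ avg g Q ≤ 4 * avg g Q₀ := by
    intro Q hQ hQQ hs hn
    by_contra hcon
    have : Q ∈ A := by
      rw [hA, Finset.mem_filter, hTm]
      refine ⟨⟨hQ, hQQ, hs⟩, ?_⟩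
      rwa [not_and_or, not_le, not_le] at hcon
    obtain ⟨R, hR, hQR⟩ := hStc Q this
    exact hn R hR hQR
  have two : (1 : ℝ) ≤ 2 ^ d := one_le_pow₀ (by norm_num)
  have hf0 := avg_nonneg f Q₀
  have hg0 := avg_nonneg g Q₀
  have bound : ∀ P ∈ St ∪ B, avg f P ≤ 4 * 2 ^ d * avg f Q₀ ∧ avg g P ≤ 4 * 2 ^ d * avg g Q₀ := by
    intro P hP
    rcases Finset.mem_union.1 hP with hP | hP
    · have hne : P ≠ Q₀ := by
        intro hPQ
        rw [hPQ] at hP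
        rcases (Finset.mem_filter.1 (hStA hP)).2 with h | h <;> linarith
      obtain ⟨R, hR, hPR, hRQ, hv, hRP⟩ := hD.exists_parent hd hQ₀ (hStT P hP).1 (hStT P hP).2.1 hne
      have hRA : R ∉ A := fun hRA => hRP (hStm P hP R hRA hPR).symm
      have hRT : R ∈ T := (hTm R).2 ⟨hR, hRQ, (hStT P hP).2.2.trans (Cube.side_mono hd hPR)⟩
      have h2 : avg f R ≤ 4 * avg f Q₀ ∧ avg g R ≤ 4 * avg g Q₀ := by
        rw [hA, Finset.mem_filter] at hRA
        push Not at hRA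
        exact hRA hRT
      have h3 := avg_le_of_subset (hf.mono_set hRQ) hPR hv
      have h4 := avg_le_of_subset (hg.mono_set hRQ) hPR hv
      constructor <;> nlinarith
    · rw [hB, Finset.mem_filter, hTm] at hP
      have := good P hP.1.1 hP.1.2.1 hP.1.2.2 hP.2.2
      constructor <;> nlinarith
  refine ⟨St ∪ B, St, Finset.subset_union_left, ?_, ?_, ?_, ?_, fun P hP => (bound P hP).1,
    fun P hP => (bound P hP).2, fun Q h1 h2 h3 h4 => (good Q h1 h2 h3 h4).1,
    fun Q h1 h2 h3 h4 => (good Q h1 h2 h3 h4).2, ?_⟩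
  · intro P hP
    rcases Finset.mem_union.1 hP with hP | hP
    · exact ⟨(hStT P hP).1, (hStT P hP).2.1⟩
    · rw [hB, Finset.mem_filter, hTm] at hP
      exact ⟨hP.1.1, hP.1.2.1⟩
  · rw [Finset.coe_union, Set.pairwiseDisjoint_union]
    have hBm : ∀ P ∈ B, P ∈ D ∧ P.side = Q₀.side / 2 ^ N ∧ ∀ R ∈ St, ¬ P.toSet ⊆ R.toSet := by
      intro P hP
      rw [hB, Finset.mem_filter, hTm] at hP
      exact ⟨hP.1.1, hP.2⟩
    refine ⟨hStd, fun P hP R hR hne => ?_, fun P hP R hR _ => ?_⟩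
    · refine Set.disjoint_left.2 fun x hxP hxR => hne ?_
      have h1 := hBm P hP
      have h2 := hBm R hR
      exact hD.eq_of_mem hd h1.1 h2.1 (h1.2.1.trans h2.2.1.symm) hxP hxR
    · refine Set.disjoint_left.2 fun x hxP hxR => ?_
      have h2 := hBm R hR
      exact h2.2.2 P hP (hD.subset_of_mem hd (hStT P hP).1 h2.1
        (h2.2.1.le.trans (hStT P hP).2.2) hxP hxR)
  · intro x hx
    obtain ⟨R, hR, hRQ, hs, hxR⟩ := hD.exists_descendant hd hQ₀ hx N
    simp only [Set.mem_iUnion]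
    by_cases hex : ∃ P ∈ St, R.toSet ⊆ P.toSet
    · obtain ⟨P, hP, hRP⟩ := hex
      exact ⟨P, Finset.mem_union_left _ hP, hRP hxR⟩
    · push Not at hex
      refine ⟨R, Finset.mem_union_right _ ?_, hxR⟩
      rw [hB, Finset.mem_filter, hTm]
      exact ⟨⟨hR, hRQ, hs.ge⟩, hs, hex⟩
  · intro P hP hPS
    rcases Finset.mem_union.1 hP with hP | hP
    · exact absurd hP hPS
    · exact (Finset.mem_filter.1 hP).2.1
  · have key : ∀ {u : (Fin d → ℝ) → ℝ}, IntegrableOn u Q₀.toSet →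
        ∑ P ∈ St with 4 * avg u Q₀ < avg u P, P.vol ≤ Q₀.vol / 4 := fun hu =>
      sum_vol_le_of_avg_lt hu (fun P hP => (hStT P (Finset.mem_filter.1 hP).1).2.1)
        (hStd.subset fun P hP => (Finset.mem_filter.1 hP).1) fun P hP => (Finset.mem_filter.1 hP).2
    have hsub : St ⊆ (St.filter fun P => 4 * avg f Q₀ < avg f P) ∪
        St.filter fun P => 4 * avg g Q₀ < avg g P := by
      intro P hP
      have := (Finset.mem_filter.1 (hStA hP)).2
      simp only [Finset.mem_union, Finset.mem_filter]
      tauto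
    calc ∑ P ∈ St, P.vol ≤ ∑ P ∈ (St.filter fun P => 4 * avg f Q₀ < avg f P) ∪
        St.filter fun P => 4 * avg g Q₀ < avg g P, P.vol :=
          Finset.sum_le_sum_of_subset_of_nonneg hsub fun P _ _ => P.vol_pos.le
      _ ≤ ∑ P ∈ St with 4 * avg f Q₀ < avg f P, P.vol +
          ∑ P ∈ St with 4 * avg g Q₀ < avg g P, P.vol := by
        rw [← Finset.sum_union_inter]
        exact le_add_of_nonneg_right (Finset.sum_nonneg fun P _ => P.vol_pos.le)
      _ ≤ Q₀.vol / 2 := by linarith [key hf, key hg]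

/-! ### Averaging over a disjoint family of cubes -/

/-- The average of `f` over the cubes of a disjoint family. -/
noncomputable def condAvg (J : Finset (Cube d)) (f : (Fin d → ℝ) → ℝ) (x : Fin d → ℝ) : ℝ :=
  ∑ P ∈ J, P.toSet.indicator (fun _ => (∫ y in P.toSet, f y) / P.vol) x

section condAvg

variable {J : Finset (Cube d)} (hdisj : (J : Set (Cube d)).PairwiseDisjoint Cube.toSet)
  (f : (Fin d → ℝ) → ℝ)

lemma measurable_condAvg : Measurable (condAvg J f) :=
  Finset.measurable_fun_sum J fun P _ => measurable_const.indicator P.measurableSet_toSet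

include hdisj

lemma condAvg_eq {P : Cube d} (hP : P ∈ J) {x : Fin d → ℝ} (hx : x ∈ P.toSet) :
    condAvg J f x = (∫ y in P.toSet, f y) / P.vol := by
  rw [condAvg, Finset.sum_eq_single_of_mem P hP, Set.indicator_of_mem hx]
  intro R hR hne
  exact Set.indicator_of_notMem
    (Set.disjoint_left.1 (hdisj hP hR hne.symm) hx) _

lemma abs_condAvg_le {P : Cube d} (hP : P ∈ J) {x : Fin d → ℝ} (hx : x ∈ P.toSet) :
    |condAvg J f x| ≤ avg f P := by
  rw [condAvg_eq hdisj f hP hx, abs_div, abs_of_pos P.vol_pos, avg]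
  exact div_le_div_of_nonneg_right (abs_integral_le_integral_abs) P.vol_pos.le

lemma setIntegral_condAvg {P : Cube d} (hP : P ∈ J) :
    ∫ x in P.toSet, condAvg J f x = ∫ x in P.toSet, f x := by
  rw [setIntegral_congr_fun P.measurableSet_toSet fun x hx => condAvg_eq hdisj f hP hx,
    setIntegral_const, smul_eq_mul]
  exact mul_div_cancel₀ _ P.vol_pos.ne'

lemma abs_condAvg_le_indicator {A : Set (Fin d → ℝ)} (hJ : ∀ P ∈ J, P.toSet ⊆ A) {c : ℝ}
    (hc0 : 0 ≤ c) (hc : ∀ P ∈ J, avg f P ≤ c) (x : Fin d → ℝ) :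
    |condAvg J f x| ≤ A.indicator (fun _ => c) x := by
  by_cases hx : ∃ P ∈ J, x ∈ P.toSet
  · obtain ⟨P, hP, hxP⟩ := hx
    rw [Set.indicator_of_mem (hJ P hP hxP)]
    exact (abs_condAvg_le hdisj f hP hxP).trans (hc P hP)
  · push Not at hx
    have : condAvg J f x = 0 :=
      Finset.sum_eq_zero fun P hP => Set.indicator_of_notMem (hx P hP) _
    rw [this, abs_zero]
    exact Set.indicator_nonneg (fun _ _ => hc0) x

omit hdisj in
lemma integrable_condAvg : Integrable (condAvg J f) volume :=
  integrable_finsetSum J fun P _ => (integrable_indicator_iff P.measurableSet_toSet).2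
    (integrableOn_const P.volume_ne_top)

lemma setIntegral_abs_condAvg_le {P : Cube d} (hP : P ∈ J) :
    ∫ x in P.toSet, |condAvg J f x| ≤ ∫ x in P.toSet, |f x| := by
  rw [← avg_mul_vol f P]
  calc ∫ x in P.toSet, |condAvg J f x| ≤ ∫ x in P.toSet, avg f P :=
        setIntegral_mono_on (integrable_condAvg f).abs.integrableOn
          (integrableOn_const P.volume_ne_top) P.measurableSet_toSet
          fun x hx => abs_condAvg_le hdisj f hP hx
    _ = avg f P * P.vol := by rw [setIntegral_const, smul_eq_mul, mul_comm]; rfl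

lemma setIntegral_sub_condAvg {P : Cube d} (hP : P ∈ J) (hf : IntegrableOn f P.toSet) :
    ∫ x in P.toSet, (f x - condAvg J f x) = 0 := by
  rw [integral_sub hf (integrable_condAvg f).integrableOn, setIntegral_condAvg hdisj f hP, sub_self]

lemma setIntegral_abs_sub_condAvg_le {P : Cube d} (hP : P ∈ J) (hf : IntegrableOn f P.toSet) :
    ∫ x in P.toSet, |f x - condAvg J f x| ≤ 2 * ∫ x in P.toSet, |f x| := by
  have hi : IntegrableOn (condAvg J f) P.toSet := (integrable_condAvg f).integrableOn
  calc ∫ x in P.toSet, |f x - condAvg J f x|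
      ≤ ∫ x in P.toSet, (|f x| + |condAvg J f x|) :=
        integral_mono (hf.sub hi).abs (hf.abs.add hi.abs) fun x => abs_sub _ _
    _ = (∫ x in P.toSet, |f x|) + ∫ x in P.toSet, |condAvg J f x| :=
        integral_add hf.abs hi.abs
    _ ≤ 2 * ∫ x in P.toSet, |f x| := by
        linarith [setIntegral_abs_condAvg_le hdisj f hP]

end condAvg

/-! ### Counting ancestors and the local estimate -/

/-- A dyadic cube has few ancestors of comparable size. -/
lemma IsDyadicGrid.card_ancestors_le {D : Set (Cube d)} (hD : IsDyadicGrid D) (hd : 0 < d)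
    (F : Finset (Cube d)) (hF : ∀ Q ∈ F, Q ∈ D) {P : Cube d} (hP : P ∈ D) (n : ℕ)
    (h : ∀ Q ∈ F, P.toSet ⊆ Q.toSet ∧ Q.side / 2 ^ n < P.side) : F.card ≤ n := by
  classical
  have hk : ∀ Q ∈ F, ∃ k : ℕ, P.side = Q.side / 2 ^ k := fun Q hQ =>
    hD.exists_side_eq (hF Q hQ) hP (Cube.side_mono hd (h Q hQ).1)
  choose! k hk using hk
  rw [← Finset.card_range n]
  refine Finset.card_le_card_of_injOn k (fun Q hQ => ?_) fun Q hQ R hR hQR => ?_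
  · have h1 := (h Q hQ).2
    rw [hk Q hQ, div_lt_div_iff_of_pos_left Q.side_pos (by positivity) (by positivity)] at h1
    -- The strict size condition leaves the generations `0, …, n - 1`, with `P` itself counted as
    -- generation `0`.
    simpa using (pow_lt_pow_iff_right₀ (one_lt_two)).1 h1
  · have h1 := hk Q hQ
    have h2 := hk R hR
    rw [h1, hQR] at h2
    have h3 : Q.side = R.side := by
      field_simp at h2; exact h2
    exact hD.eq_of_mem hd (hF Q hQ) (hF R hR) h3 ((h Q hQ).1 P.corner_mem)
      ((h R hR).1 P.corner_mem)

open scoped Classical in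
/-- Double counting of pairs of a cube and one of its ancestors. -/
lemma IsDyadicGrid.sum_sum_ancestors_le {D : Set (Cube d)} (hD : IsDyadicGrid D) (hd : 0 < d)
    (F J : Finset (Cube d)) (hF : ∀ Q ∈ F, Q ∈ D) (hJ : ∀ P ∈ J, P ∈ D) (n : ℕ)
    (u : Cube d → ℝ) (hu : ∀ P, 0 ≤ u P) :
    ∑ Q ∈ F, ∑ P ∈ (J.filter fun P => P.toSet ⊆ Q.toSet) with Q.side / 2 ^ n < P.side, u P ≤
      n * ∑ P ∈ J, u P := by
  simp only [Finset.filter_filter, Finset.sum_filter]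
  rw [Finset.sum_comm, Finset.mul_sum]
  refine Finset.sum_le_sum fun P hP => ?_
  rw [← Finset.sum_filter, Finset.sum_const, nsmul_eq_mul]
  refine mul_le_mul_of_nonneg_right ?_ (hu P)
  exact_mod_cast hD.card_ancestors_le hd _ (fun Q hQ => hF Q (Finset.mem_filter.1 hQ).1)
    (hJ P hP) n fun Q hQ => (Finset.mem_filter.1 hQ).2

/-- The local estimate: the part of the form above the stopping cubes is controlled by the
averages over the top cube. -/
lemma IsHaarShift.abs_sum_form_le_avg {D : Set (Cube d)} {m n : ℕ}
    {s : Cube d → (Fin d → ℝ) → (Fin d → ℝ) → ℝ}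
    {S : Lp ℝ 2 (volume : Measure (Fin d → ℝ)) →ₗ[ℝ] Lp ℝ 2 (volume : Measure (Fin d → ℝ))}
    (h : IsHaarShift D m n s S) (hd : 0 < d) {Q₀ : Cube d} {N : ℕ}
    {f g : (Fin d → ℝ) → ℝ} (hf : IntegrableOn f Q₀.toSet) (hg : IntegrableOn g Q₀.toSet)
    {J St : Finset (Cube d)} (hJ : IsStopping D Q₀ N f g J St) (F : Finset (Cube d))
    (hF : ∀ Q ∈ F, Q ∈ D ∧ Q.toSet ⊆ Q₀.toSet ∧ Q₀.side / 2 ^ N ≤ Q.side ∧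
      ∀ P ∈ St, ¬ Q.toSet ⊆ P.toSet) :
    |∑ Q ∈ F, form s Q f g| ≤ 16 * (4 ^ d + complexity m n) * (avg f Q₀ * avg g Q₀ * Q₀.vol) := by
  classical
  have hD := h.grid
  have hfa := avg_nonneg f Q₀
  have hga := avg_nonneg g Q₀
  set f' := condAvg J f with hf'
  set g' := condAvg J g with hg'
  have hfI : ∀ Q ∈ F, IntegrableOn f Q.toSet := fun Q hQ => hf.mono_set (hF Q hQ).2.1
  have hgI : ∀ Q ∈ F, IntegrableOn g Q.toSet := fun Q hQ => hg.mono_set (hF Q hQ).2.1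
  have hf'I : ∀ Q : Cube d, IntegrableOn f' Q.toSet := fun Q => (integrable_condAvg f).integrableOn
  have hg'I : ∀ Q : Cube d, IntegrableOn g' Q.toSet := fun Q => (integrable_condAvg g).integrableOn
  have hJf : ∀ P ∈ J, IntegrableOn f P.toSet := fun P hP => hf.mono_set (hJ.mem P hP).2
  have hJg : ∀ P ∈ J, IntegrableOn g P.toSet := fun P hP => hg.mono_set (hJ.mem P hP).2
  -- the cubes of the partition inside a cube of the family cover it
  have hcov : ∀ Q ∈ F, Q.toSet ⊆ ⋃ P ∈ J.filter fun P => P.toSet ⊆ Q.toSet, P.toSet := by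
    intro Q hQ x hx
    obtain ⟨hQD, hQQ, hQs, hQS⟩ := hF Q hQ
    have := hJ.cover (hQQ hx)
    simp only [Set.mem_iUnion] at this ⊢
    obtain ⟨P, hP, hxP⟩ := this
    refine ⟨P, Finset.mem_filter.2 ⟨hP, ?_⟩, hxP⟩
    have hle : P.side ≤ Q.side := by
      by_cases hPS : P ∈ St
      · by_contra! hlt
        exact hQS P hPS (hD.subset_of_mem hd (hJ.mem P hP).1 hQD hlt.le hxP hx)
      · rw [hJ.side_eq P hP hPS]; exact hQs
    exact hD.subset_of_mem hd hQD (hJ.mem P hP).1 hle hx hxP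
  have hmem : ∀ Q : Cube d, ∀ P ∈ J.filter (fun P => P.toSet ⊆ Q.toSet),
      P ∈ D ∧ P.toSet ⊆ Q.toSet :=
    fun Q P hP => ⟨(hJ.mem P (Finset.mem_filter.1 hP).1).1, (Finset.mem_filter.1 hP).2⟩
  have hdis : ∀ Q : Cube d, ((J.filter fun P => P.toSet ⊆ Q.toSet : Finset (Cube d)) :
      Set (Cube d)).PairwiseDisjoint Cube.toSet := fun Q =>
    hJ.disjoint.subset fun P hP => (Finset.mem_filter.1 hP).1
  have havgf : ∀ Q ∈ F, (∫ x in Q.toSet, |f x|) / Q.vol ≤ 4 * avg f Q₀ := fun Q hQ =>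
    hJ.good_left Q (hF Q hQ).1 (hF Q hQ).2.1 (hF Q hQ).2.2.1 (hF Q hQ).2.2.2
  -- `Q` is a union of cubes of `J`, and averaging over them does not increase the `L¹` norm.
  have havgg' : ∀ Q ∈ F, (∫ x in Q.toSet, |g' x|) / Q.vol ≤ 4 * avg g Q₀ := by
    intro Q hQ
    refine le_trans (div_le_div_of_nonneg_right ?_ Q.vol_pos.le)
      (hJ.good_right Q (hF Q hQ).1 (hF Q hQ).2.1 (hF Q hQ).2.2.1 (hF Q hQ).2.2.2)
    have hQe : Q.toSet = ⋃ P ∈ J.filter fun P => P.toSet ⊆ Q.toSet, P.toSet :=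
      (hcov Q hQ).antisymm (Set.iUnion₂_subset fun P hp => (hmem Q P hp).2)
    calc ∫ x in Q.toSet, |g' x|
        = ∑ P ∈ J.filter fun P => P.toSet ⊆ Q.toSet, ∫ x in P.toSet, |g' x| := by
          conv_lhs => rw [hQe]
          exact integral_biUnion_finset _ (fun P _ => P.measurableSet_toSet) (hdis Q)
            fun P _ => (hg'I P).abs
      _ ≤ ∑ P ∈ J.filter fun P => P.toSet ⊆ Q.toSet, ∫ x in P.toSet, |g x| :=
          Finset.sum_le_sum fun P hP =>
            setIntegral_abs_condAvg_le hJ.disjoint g (Finset.mem_filter.1 hP).1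
      _ ≤ ∫ x in Q.toSet, |g x| :=
          sum_setIntegral_abs_le (hgI Q hQ) (fun P hP => (hmem Q P hP).2) (hdis Q)
  have hsumJ : ∀ {u : (Fin d → ℝ) → ℝ}, IntegrableOn u Q₀.toSet →
      ∑ P ∈ J, ∫ x in P.toSet, |u x - condAvg J u x| ≤ 2 * (avg u Q₀ * Q₀.vol) := by
    intro u hu
    rw [avg_mul_vol]
    calc _ ≤ ∑ P ∈ J, 2 * ∫ x in P.toSet, |u x| := Finset.sum_le_sum fun P hP =>
          setIntegral_abs_sub_condAvg_le hJ.disjoint u hP (hu.mono_set (hJ.mem P hP).2)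
      _ ≤ _ := by
          rw [← Finset.mul_sum]
          exact mul_le_mul_of_nonneg_left
            (sum_setIntegral_abs_le hu (fun P hP => (hJ.mem P hP).2) hJ.disjoint) zero_le_two
  -- The factor `16 * 4 ^ d` is the square of the bound `4 * 2 ^ d` for the averages over cubes of
  -- `J`.
  have main : |∑ Q ∈ F, form s Q f' g'| ≤ 16 * 4 ^ d * (avg f Q₀ * avg g Q₀ * Q₀.vol) := by
    refine (h.abs_sum_form_le_of_bounded hd F (fun Q hQ => ⟨(hF Q hQ).1, (hF Q hQ).2.1⟩)
      (measurable_condAvg f) (measurable_condAvg g)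
      (abs_condAvg_le_indicator hJ.disjoint f (fun P hP => (hJ.mem P hP).2)
        (by positivity) hJ.avg_left)
      (abs_condAvg_le_indicator hJ.disjoint g (fun P hP => (hJ.mem P hP).2)
        (by positivity) hJ.avg_right) (by positivity) (by positivity)).trans (le_of_eq ?_)
    have : (4 : ℝ) ^ d = 2 ^ d * 2 ^ d := by rw [← mul_pow]; norm_num
    rw [this]; ring
  -- The factor `8 n` collects at most `n` ancestors, the `2` from the `L¹` norm of `f - f'`, and
  -- the threshold `4` for `g'`.
  have err1 : ∑ Q ∈ F, |form s Q (fun x => f x - f' x) g'| ≤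
      8 * n * (avg f Q₀ * avg g Q₀ * Q₀.vol) := by
    calc ∑ Q ∈ F, |form s Q (fun x => f x - f' x) g'|
        ≤ ∑ Q ∈ F, (∑ P ∈ (J.filter fun P => P.toSet ⊆ Q.toSet) with Q.side / 2 ^ n < P.side,
            ∫ x in P.toSet, |f x - f' x|) * (4 * avg g Q₀) := by
          refine Finset.sum_le_sum fun Q hQ => ?_
          refine (h.abs_form_le_of_mean_zero_left hd (hF Q hQ).1 ((hfI Q hQ).sub (hf'I Q)) (hg'I Q)
            _ (hmem Q) (hdis Q) (hcov Q hQ) fun P hP => setIntegral_sub_condAvg hJ.disjoint f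
              (Finset.mem_filter.1 hP).1 (hJf P (Finset.mem_filter.1 hP).1)).trans ?_
          exact mul_le_mul_of_nonneg_left (havgg' Q hQ)
            (Finset.sum_nonneg fun P _ => integral_nonneg fun _ => abs_nonneg _)
      _ ≤ n * (2 * (avg f Q₀ * Q₀.vol)) * (4 * avg g Q₀) := by
          rw [← Finset.sum_mul]
          refine mul_le_mul_of_nonneg_right ?_ (by positivity)
          refine (hD.sum_sum_ancestors_le hd F J (fun Q hQ => (hF Q hQ).1)
            (fun P hP => (hJ.mem P hP).1) n (fun P => ∫ x in P.toSet, |f x - f' x|)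
            fun P => integral_nonneg fun _ => abs_nonneg _).trans ?_
          exact mul_le_mul_of_nonneg_left (hsumJ hf) (Nat.cast_nonneg n)
      _ = _ := by ring
  have err2 : ∑ Q ∈ F, |form s Q f (fun x => g x - g' x)| ≤
      8 * m * (avg f Q₀ * avg g Q₀ * Q₀.vol) := by
    calc ∑ Q ∈ F, |form s Q f (fun x => g x - g' x)|
        ≤ ∑ Q ∈ F, (∑ P ∈ (J.filter fun P => P.toSet ⊆ Q.toSet) with Q.side / 2 ^ m < P.side,
            ∫ x in P.toSet, |g x - g' x|) * (4 * avg f Q₀) := by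
          refine Finset.sum_le_sum fun Q hQ => ?_
          refine (h.abs_form_le_of_mean_zero_right hd (hF Q hQ).1 (hfI Q hQ)
            ((hgI Q hQ).sub (hg'I Q)) _ (hmem Q) (hdis Q) (hcov Q hQ)
            fun P hP => setIntegral_sub_condAvg hJ.disjoint g
              (Finset.mem_filter.1 hP).1 (hJg P (Finset.mem_filter.1 hP).1)).trans ?_
          exact mul_le_mul_of_nonneg_left (havgf Q hQ)
            (Finset.sum_nonneg fun P _ => integral_nonneg fun _ => abs_nonneg _)
      _ ≤ m * (2 * (avg g Q₀ * Q₀.vol)) * (4 * avg f Q₀) := by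
          rw [← Finset.sum_mul]
          refine mul_le_mul_of_nonneg_right ?_ (by positivity)
          refine (hD.sum_sum_ancestors_le hd F J (fun Q hQ => (hF Q hQ).1)
            (fun P hP => (hJ.mem P hP).1) m (fun P => ∫ x in P.toSet, |g x - g' x|)
            fun P => integral_nonneg fun _ => abs_nonneg _).trans ?_
          exact mul_le_mul_of_nonneg_left (hsumJ hg) (Nat.cast_nonneg m)
      _ = _ := by ring
  -- The second remainder is paired with `f` itself, not `f'`; this suffices because the means of
  -- `|f|` over the cubes of `F` are controlled.
  have split : ∑ Q ∈ F, form s Q f g = ∑ Q ∈ F, form s Q f' g' +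
      (∑ Q ∈ F, form s Q (fun x => f x - f' x) g' +
        ∑ Q ∈ F, form s Q f (fun x => g x - g' x)) := by
    rw [← Finset.sum_add_distrib, ← Finset.sum_add_distrib]
    refine Finset.sum_congr rfl fun Q hQ => ?_
    rw [h.form_sub_left hd (hF Q hQ).1 (hfI Q hQ) (hf'I Q) (hg'I Q),
      h.form_sub_right hd (hF Q hQ).1 (hfI Q hQ) (hgI Q hQ) (hg'I Q)]
    ring
  have hκ : (n : ℝ) + m ≤ 2 * complexity m n := by
    rw [complexity]
    push_cast
    linarith [le_max_left (m : ℝ) n, le_max_right (m : ℝ) n]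
  have hpos : 0 ≤ avg f Q₀ * avg g Q₀ * Q₀.vol := by have := Q₀.vol_pos; positivity
  rw [split]
  refine (abs_add_le _ _).trans ?_
  have e := (abs_add_le (∑ Q ∈ F, form s Q (fun x => f x - f' x) g')
    (∑ Q ∈ F, form s Q f (fun x => g x - g' x)))
  have e1 := (Finset.abs_sum_le_sum_abs (fun Q => form s Q (fun x => f x - f' x) g') F).trans err1
  have e2 := (Finset.abs_sum_le_sum_abs (fun Q => form s Q f (fun x => g x - g' x)) F).trans err2
  nlinarith [mul_le_mul_of_nonneg_right hκ hpos]

/-! ### Dyadic maximal functions and Doob's inequality -/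

/-- The supremum of `a Q` over the cubes `Q ∈ G` containing a point. -/
noncomputable def maxFun (G : Finset (Cube d)) (a : Cube d → ℝ≥0∞) (x : Fin d → ℝ) : ℝ≥0∞ :=
  G.sup fun Q => Q.toSet.indicator (fun _ => a Q) x

lemma measurable_maxFun (G : Finset (Cube d)) (a : Cube d → ℝ≥0∞) : Measurable (maxFun G a) := by
  have : maxFun G a = G.sup fun Q => Q.toSet.indicator (fun _ => a Q) := by
    ext x; rw [maxFun, Finset.sup_apply]
  rw [this]
  exact Finset.sup_induction measurable_const (fun f hf g hg => hf.sup hg)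
    fun Q _ => measurable_const.indicator Q.measurableSet_toSet

lemma le_maxFun {G : Finset (Cube d)} {a : Cube d → ℝ≥0∞} {Q : Cube d} (hQ : Q ∈ G)
    {x : Fin d → ℝ} (hx : x ∈ Q.toSet) : a Q ≤ maxFun G a x := by
  refine le_trans (le_of_eq ?_)
    (Finset.le_sup (f := fun Q => Q.toSet.indicator (fun _ => a Q) x) hQ)
  rw [Set.indicator_of_mem hx]

lemma lt_maxFun_iff {G : Finset (Cube d)} {a : Cube d → ℝ≥0∞} {t : ℝ≥0∞} {x : Fin d → ℝ} :
    t < maxFun G a x ↔ ∃ Q ∈ G, t < a Q ∧ x ∈ Q.toSet := by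
  rw [maxFun, Finset.lt_sup_iff]
  refine exists_congr fun Q => and_congr_right fun _ => ?_
  by_cases hx : x ∈ Q.toSet <;> simp [hx]

lemma maxFun_lt_top {G : Finset (Cube d)} {a : Cube d → ℝ≥0∞} (ha : ∀ Q ∈ G, a Q ≠ ∞)
    (x : Fin d → ℝ) : maxFun G a x < ∞ := by
  rw [maxFun, Finset.sup_lt_iff (by simp)]
  intro Q hQ
  exact (Set.indicator_le_self _ _ x).trans_lt (ha Q hQ).lt_top

lemma lintegral_maxFun_sq_lt_top {G : Finset (Cube d)} {a : Cube d → ℝ≥0∞}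
    (ha : ∀ Q ∈ G, a Q ≠ ∞) {μ : Measure (Fin d → ℝ)} (hμ : ∀ Q ∈ G, μ Q.toSet ≠ ∞) :
    ∫⁻ x, maxFun G a x ^ 2 ∂μ < ∞ := by
  have hle : ∀ x, maxFun G a x ^ 2 ≤ ∑ Q ∈ G, Q.toSet.indicator (fun _ => a Q ^ 2) x := by
    intro x
    rcases G.eq_empty_or_nonempty with rfl | hG
    · simp [maxFun]
    obtain ⟨Q, hQ, hQe⟩ := Finset.exists_mem_eq_sup G hG fun Q => Q.toSet.indicator (fun _ => a Q) x
    rw [maxFun, hQe]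
    refine le_trans (le_of_eq ?_) (Finset.single_le_sum
      (f := fun Q : Cube d => Q.toSet.indicator (fun _ => a Q ^ 2) x) (fun _ _ => zero_le) hQ)
    by_cases hx : x ∈ Q.toSet <;> simp [hx]
  refine (lintegral_mono hle).trans_lt ?_
  rw [lintegral_finsetSum _ fun Q _ => measurable_const.indicator Q.measurableSet_toSet]
  refine ENNReal.sum_lt_top.2 fun Q hQ => ?_
  rw [lintegral_indicator_const Q.measurableSet_toSet]
  exact ENNReal.mul_lt_top (ENNReal.pow_lt_top (ha Q hQ).lt_top) (hμ Q hQ).lt_top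

/-- Doob's weak type inequality for the dyadic maximal function. -/
lemma IsDyadicGrid.mul_measure_lt_maxFun_le {D : Set (Cube d)} (hD : IsDyadicGrid D) (hd : 0 < d)
    (G : Finset (Cube d)) (hG : ∀ Q ∈ G, Q ∈ D) (μ ν : Measure (Fin d → ℝ)) (t : ℝ≥0∞) :
    t * μ {x | t < maxFun G (fun Q => ν Q.toSet / μ Q.toSet) x} ≤
      ν {x | t < maxFun G (fun Q => ν Q.toSet / μ Q.toSet) x} := by
  classical
  set a : Cube d → ℝ≥0∞ := fun Q => ν Q.toSet / μ Q.toSet with ha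
  -- The level set is the disjoint union of its maximal cubes, on each of which the ratio `ν / μ`
  -- exceeds `t`.
  obtain ⟨A, hA, hdisj, hcov, -⟩ := hD.exists_maximal hd (G.filter fun Q => t < a Q)
    fun Q hQ => hG Q (Finset.mem_filter.1 hQ).1
  have hset : {x | t < maxFun G a x} = ⋃ Q ∈ A, Q.toSet := by
    ext x
    change t < maxFun G a x ↔ _
    rw [lt_maxFun_iff]
    simp only [Set.mem_iUnion]
    constructor
    · rintro ⟨Q, hQ, ht, hx⟩
      obtain ⟨R, hR, hQR⟩ := hcov Q (Finset.mem_filter.2 ⟨hQ, ht⟩)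
      exact ⟨R, hR, hQR hx⟩
    · rintro ⟨Q, hQ, hx⟩
      have := Finset.mem_filter.1 (hA hQ)
      exact ⟨Q, this.1, this.2, hx⟩
  rw [hset, measure_biUnion_finset hdisj fun Q _ => Q.measurableSet_toSet,
    measure_biUnion_finset hdisj fun Q _ => Q.measurableSet_toSet, Finset.mul_sum]
  exact Finset.sum_le_sum fun Q hQ =>
    ENNReal.mul_le_of_le_div (Finset.mem_filter.1 (hA hQ)).2.le

/-- This is `(2a - b)² ≥ 0`, weighted so that half of the square of the maximal function can be
absorbed in Doob's inequality. -/
lemma two_mul_mul_le (a b : ℝ≥0∞) : 2 * (a * b) ≤ 2 * a ^ 2 + b ^ 2 / 2 := by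
  rcases eq_or_ne a ∞ with rfl | ha
  · simp
  rcases eq_or_ne b ∞ with rfl | hb
  · simp [ENNReal.top_div]
  lift a to ℝ≥0 using ha
  lift b to ℝ≥0 using hb
  have : 2 * (a * b) ≤ 2 * a ^ 2 + b ^ 2 / 2 := by
    rw [← NNReal.coe_le_coe]
    push_cast
    nlinarith [sq_nonneg (2 * (a : ℝ) - b)]
  have h2 : ((b ^ 2 / 2 : ℝ≥0) : ℝ≥0∞) = (b : ℝ≥0∞) ^ 2 / 2 := by
    rw [ENNReal.coe_div two_ne_zero]; norm_cast
  rw [← h2]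
  exact_mod_cast this

/-- Doob's `L²` inequality for the dyadic maximal function over a finite family of cubes. -/
lemma IsDyadicGrid.lintegral_maxFun_sq_le {D : Set (Cube d)} (hD : IsDyadicGrid D) (hd : 0 < d)
    (G : Finset (Cube d)) (hG : ∀ Q ∈ G, Q ∈ D) (μ : Measure (Fin d → ℝ)) {h : (Fin d → ℝ) → ℝ≥0∞}
    (hh : AEMeasurable h μ) (hμ : ∀ Q ∈ G, μ Q.toSet ≠ ∞)
    (ha : ∀ Q ∈ G, (∫⁻ x in Q.toSet, h x ∂μ) / μ Q.toSet ≠ ∞) :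
    ∫⁻ x, maxFun G (fun Q => (∫⁻ x in Q.toSet, h x ∂μ) / μ Q.toSet) x ^ 2 ∂μ ≤
      4 * ∫⁻ x, h x ^ 2 ∂μ := by
  set ν := μ.withDensity h with hν
  have hνQ : ∀ Q : Cube d, ∫⁻ x in Q.toSet, h x ∂μ = ν Q.toSet := fun Q =>
    (withDensity_apply _ Q.measurableSet_toSet).symm
  simp only [hνQ] at ha ⊢
  set M := maxFun G (fun Q => ν Q.toSet / μ Q.toSet) with hM
  have hMm : Measurable M := measurable_maxFun _ _
  have hMt : ∀ x, M x < ∞ := maxFun_lt_top ha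
  -- A priori finiteness, available since `G` is finite; it is what permits the absorption below.
  have hX : ∫⁻ x, M x ^ 2 ∂μ < ∞ := lintegral_maxFun_sq_lt_top ha hμ
  have h1 : ∫⁻ x, M x ^ 2 ∂μ ≤ 2 * ∫⁻ x, M x ∂ν := by
    -- Two layer-cake formulas, for `∫ M² dμ` and `∫ M dν`; the weak type inequality compares their
    -- integrands level by level.
    have e1 := lintegral_rpow_eq_lintegral_meas_lt_mul μ (f := fun x => (M x).toReal)
      (ae_of_all _ fun x => ENNReal.toReal_nonneg) hMm.ennreal_toReal.aemeasurable (p := 2) two_pos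
    have e2 := lintegral_eq_lintegral_meas_lt ν (f := fun x => (M x).toReal)
      (ae_of_all _ fun x => ENNReal.toReal_nonneg) hMm.ennreal_toReal.aemeasurable
    have e3 : ∀ x, ENNReal.ofReal ((M x).toReal ^ (2 : ℝ)) = M x ^ 2 := fun x => by
      rw [Real.rpow_two, ENNReal.ofReal_pow ENNReal.toReal_nonneg,
        ENNReal.ofReal_toReal (hMt x).ne]
    simp only [e3] at e1
    simp only [ENNReal.ofReal_toReal (hMt _).ne] at e2
    rw [e1, e2]
    have : ENNReal.ofReal 2 = 2 := by norm_num
    rw [this]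
    refine mul_le_mul_right (setLIntegral_mono' measurableSet_Ioi fun t ht => ?_) 2
    have e4 : {x | t < (M x).toReal} = {x | ENNReal.ofReal t < M x} := by
      ext x
      exact (ENNReal.ofReal_lt_iff_lt_toReal (le_of_lt ht) (hMt x).ne).symm
    rw [e4, mul_comm]
    have e5 : t ^ ((2 : ℝ) - 1) = t := by norm_num
    rw [e5]
    exact hD.mul_measure_lt_maxFun_le hd G hG μ ν _
  have h2 : ∫⁻ x, M x ∂ν = ∫⁻ x, h x * M x ∂μ := by
    rw [hν, lintegral_withDensity_eq_lintegral_mul₀ hh hMm.aemeasurable]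
    rfl
  have h3 : ∫⁻ x, M x ^ 2 ∂μ ≤ 2 * ∫⁻ x, h x ^ 2 ∂μ + (∫⁻ x, M x ^ 2 ∂μ) / 2 := by
    calc ∫⁻ x, M x ^ 2 ∂μ ≤ 2 * ∫⁻ x, h x * M x ∂μ := h2 ▸ h1
      _ = ∫⁻ x, 2 * (h x * M x) ∂μ :=
          (lintegral_const_mul'' _ (hh.mul hMm.aemeasurable)).symm
      _ ≤ ∫⁻ x, (2 * h x ^ 2 + M x ^ 2 / 2) ∂μ := lintegral_mono fun x => two_mul_mul_le _ _
      _ = 2 * ∫⁻ x, h x ^ 2 ∂μ + (∫⁻ x, M x ^ 2 ∂μ) / 2 := by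
          rw [lintegral_add_right' _ ((hMm.pow_const 2).div_const 2).aemeasurable,
            lintegral_const_mul'' _ (hh.pow_const 2)]
          simp only [div_eq_mul_inv]
          rw [lintegral_mul_const _ (hMm.pow_const 2)]
  set X := ∫⁻ x, M x ^ 2 ∂μ with hXd
  have h4 : X / 2 ≤ 2 * ∫⁻ x, h x ^ 2 ∂μ := by
    have e : X / 2 + X / 2 ≤ 2 * ∫⁻ x, h x ^ 2 ∂μ + X / 2 := by rwa [ENNReal.add_halves]
    exact (ENNReal.add_le_add_iff_right (ENNReal.div_lt_top hX.ne two_ne_zero).ne).1 e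
  calc X = 2 * (X / 2) := (ENNReal.mul_div_cancel two_ne_zero ENNReal.ofNat_ne_top).symm
    _ ≤ 2 * (2 * ∫⁻ x, h x ^ 2 ∂μ) := by gcongr
    _ = 4 * ∫⁻ x, h x ^ 2 ∂μ := by rw [← mul_assoc]; norm_num

/-! ### Iterating the stopping construction -/

lemma IsStopping.ofReal_vol_le {D : Set (Cube d)} {Q₀ : Cube d} {N : ℕ} {f g : (Fin d → ℝ) → ℝ}
    {J St : Finset (Cube d)} (hJ : IsStopping D Q₀ N f g J St) :
    ENNReal.ofReal Q₀.vol ≤ 2 * volume (Q₀.toSet \ ⋃ P ∈ St, P.toSet) := by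
  have hfin : volume (⋃ P ∈ St, P.toSet) ≠ ∞ :=
    ((measure_biUnion_finset_le St _).trans_lt
      (ENNReal.sum_lt_top.2 fun P _ => P.volume_ne_top.lt_top)).ne
  have h1 : volume (⋃ P ∈ St, P.toSet) ≤ ENNReal.ofReal (Q₀.vol / 2) := by
    refine (measure_biUnion_finset_le St _).trans ?_
    simp only [← Cube.ofReal_vol]
    rw [← ENNReal.ofReal_sum_of_nonneg fun P _ => P.vol_pos.le]
    exact ENNReal.ofReal_le_ofReal hJ.sum_vol
  have h2 := le_measure_sdiff (μ := volume) (s₁ := Q₀.toSet) (s₂ := ⋃ P ∈ St, P.toSet)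
  rw [← Cube.ofReal_vol] at h2
  have h3 : ENNReal.ofReal (Q₀.vol / 2) ≤ volume (Q₀.toSet \ ⋃ P ∈ St, P.toSet) := by
    refine le_trans ?_ h2
    refine le_trans (le_of_eq ?_) (tsub_le_tsub_left h1 _)
    rw [← ENNReal.ofReal_sub _ (by linarith [Q₀.vol_pos])]
    congr 1; ring
  calc ENNReal.ofReal Q₀.vol = 2 * ENNReal.ofReal (Q₀.vol / 2) := by
        rw [← ENNReal.ofReal_ofNat, ← ENNReal.ofReal_mul zero_le_two]
        congr 1; ring
    _ ≤ _ := by gcongr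

/-- The constant in the estimate of the bilinear form. -/
noncomputable def formConst (d m n : ℕ) : ℝ := 16 * (4 ^ d + complexity m n)

lemma formConst_nonneg (d m n : ℕ) : 0 ≤ formConst d m n := by rw [formConst]; positivity

/-- Summing a function over the members of a family lying in one of several disjoint cubes. -/
lemma sum_filter_exists_subset {J : Finset (Cube d)}
    (hJ : (J : Set (Cube d)).PairwiseDisjoint Cube.toSet) (F : Finset (Cube d)) (u : Cube d → ℝ)
    [DecidablePred fun Q : Cube d => ∃ P ∈ J, Q.toSet ⊆ P.toSet]
    [∀ P : Cube d, DecidablePred fun Q : Cube d => Q.toSet ⊆ P.toSet] :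
    ∑ Q ∈ F with ∃ P ∈ J, Q.toSet ⊆ P.toSet, u Q =
      ∑ P ∈ J, ∑ Q ∈ F with Q.toSet ⊆ P.toSet, u Q := by
  classical
  rw [← Finset.sum_biUnion]
  · refine Finset.sum_congr ?_ fun _ _ => rfl
    ext Q
    simp only [Finset.mem_filter, Finset.mem_biUnion]
    tauto
  · intro P hP R hR hne
    refine Finset.disjoint_left.2 fun Q hQ hQ' => ?_
    exact Set.disjoint_left.1 (hJ hP hR hne) ((Finset.mem_filter.1 hQ).2 Q.corner_mem)
      ((Finset.mem_filter.1 hQ').2 Q.corner_mem)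

open scoped Classical in
-- Sparse domination in integrated form. The cubes of `F` outside the stopping cubes are paid for by
-- `Φ` on the part of `Q₀` that the stopping cubes leave free, at the cost of a factor `2`; the
-- others are paid for recursively on the stopping cubes. Each recursion at least halves the side,
-- and nothing remains below side `ε`, so the depth is at most `N`.
lemma IsHaarShift.ofReal_abs_sum_form_subset_le {D : Set (Cube d)} {m n : ℕ}
    {s : Cube d → (Fin d → ℝ) → (Fin d → ℝ) → ℝ}
    {S : Lp ℝ 2 (volume : Measure (Fin d → ℝ)) →ₗ[ℝ] Lp ℝ 2 (volume : Measure (Fin d → ℝ))}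
    (h : IsHaarShift D m n s S) (hd : 0 < d) {f g : (Fin d → ℝ) → ℝ} (F : Finset (Cube d))
    {ε : ℝ} (hF : ∀ Q ∈ F, Q ∈ D ∧ ε ≤ Q.side) {Φ : (Fin d → ℝ) → ℝ≥0∞} (N : ℕ) :
    ∀ Q₀ ∈ D, Q₀.side < 2 ^ N * ε → IntegrableOn f Q₀.toSet → IntegrableOn g Q₀.toSet →
    (∀ Q ∈ D, Q.toSet ⊆ Q₀.toSet → ε ≤ Q.side → ∀ x ∈ Q.toSet,
      ENNReal.ofReal (avg f Q * avg g Q) ≤ Φ x) →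
    ENNReal.ofReal |∑ Q ∈ F with Q.toSet ⊆ Q₀.toSet, form s Q f g| ≤
      2 * ENNReal.ofReal (formConst d m n) * ∫⁻ x in Q₀.toSet, Φ x := by
  have hempty : ∀ Q₀ : Cube d, Q₀.side < ε → ∑ Q ∈ F with Q.toSet ⊆ Q₀.toSet, form s Q f g = 0 := by
    intro Q₀ hs
    rw [Finset.filter_false_of_mem, Finset.sum_empty]
    intro Q hQ hsub
    linarith [(hF Q hQ).2, Cube.side_mono hd hsub]
  induction N with
  | zero =>
    intro Q₀ _ hs _ _ _
    rw [pow_zero, one_mul] at hs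
    rw [hempty Q₀ hs]
    simp
  | succ N ih =>
    intro Q₀ hQ₀ hs hf hg hΦ
    rcases lt_or_ge Q₀.side ε with hlt | hge
    · rw [hempty Q₀ hlt]
      simp
    -- Truncation at generation `N + 1` puts the unstopped cubes of the partition below side `ε`,
    -- hence below every cube of `F`.
    obtain ⟨J, St, hJ⟩ := h.grid.exists_isStopping hd hQ₀ (N + 1) hf hg
    have hs' : Q₀.side / 2 ^ (N + 1) < ε := by
      rw [div_lt_iff₀ (by positivity), mul_comm]; exact hs
    have hStD : (St : Set (Cube d)).PairwiseDisjoint Cube.toSet :=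
      hJ.disjoint.subset hJ.stopping_subset
    have hStm : ∀ P ∈ St, P ∈ D ∧ P.toSet ⊆ Q₀.toSet := fun P hP => hJ.mem P (hJ.stopping_subset hP)
    set G := F.filter fun Q => Q.toSet ⊆ Q₀.toSet with hG
    have hsplit : ∑ Q ∈ G, form s Q f g =
        ∑ Q ∈ G with ¬ ∃ P ∈ St, Q.toSet ⊆ P.toSet, form s Q f g +
          ∑ P ∈ St, ∑ Q ∈ F with Q.toSet ⊆ P.toSet, form s Q f g := by
      rw [← Finset.sum_filter_add_sum_filter_not G (fun Q => ∃ P ∈ St, Q.toSet ⊆ P.toSet), add_comm,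
        sum_filter_exists_subset hStD]
      congr 1
      refine Finset.sum_congr rfl fun P hP => Finset.sum_congr ?_ fun _ _ => rfl
      ext Q
      simp only [hG, Finset.mem_filter]
      exact ⟨fun hq => ⟨hq.1.1, hq.2⟩, fun hq => ⟨⟨hq.1, hq.2.trans (hStm P hP).2⟩, hq.2⟩⟩
    have hloc := h.abs_sum_form_le_avg hd hf hg hJ
      (G.filter fun Q => ¬ ∃ P ∈ St, Q.toSet ⊆ P.toSet) (by
        intro Q hQ
        simp only [hG, Finset.mem_filter, not_exists, not_and] at hQ
        exact ⟨(hF Q hQ.1.1).1, hQ.1.2, hs'.le.trans (hF Q hQ.1.1).2, hQ.2⟩)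
    set E := Q₀.toSet \ ⋃ P ∈ St, P.toSet with hE
    have hUm : MeasurableSet (⋃ P ∈ St, P.toSet) :=
      Finset.measurableSet_biUnion St fun P _ => P.measurableSet_toSet
    have hEm : MeasurableSet E := Q₀.measurableSet_toSet.diff hUm
    have hmain : ENNReal.ofReal |∑ Q ∈ G with ¬ ∃ P ∈ St, Q.toSet ⊆ P.toSet, form s Q f g| ≤
        2 * ENNReal.ofReal (formConst d m n) * ∫⁻ x in E, Φ x := by
      have hav : 0 ≤ avg f Q₀ * avg g Q₀ := mul_nonneg (avg_nonneg _ _) (avg_nonneg _ _)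
      calc _ ≤ ENNReal.ofReal (formConst d m n * (avg f Q₀ * avg g Q₀ * Q₀.vol)) :=
            ENNReal.ofReal_le_ofReal hloc
        _ = ENNReal.ofReal (formConst d m n) * (ENNReal.ofReal (avg f Q₀ * avg g Q₀) *
              ENNReal.ofReal Q₀.vol) := by
            rw [ENNReal.ofReal_mul (formConst_nonneg d m n), ENNReal.ofReal_mul hav]
        _ ≤ ENNReal.ofReal (formConst d m n) * (ENNReal.ofReal (avg f Q₀ * avg g Q₀) *
              (2 * volume E)) := by
            gcongr
            exact hJ.ofReal_vol_le
        _ = 2 * ENNReal.ofReal (formConst d m n) *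
              ∫⁻ _ in E, ENNReal.ofReal (avg f Q₀ * avg g Q₀) := by
            rw [setLIntegral_const]; ring
        _ ≤ _ := by
            refine mul_le_mul_right (setLIntegral_mono' hEm fun x hx => ?_) _
            exact hΦ Q₀ hQ₀ subset_rfl hge x hx.1
    have hchild : ∀ P ∈ St, ENNReal.ofReal |∑ Q ∈ F with Q.toSet ⊆ P.toSet, form s Q f g| ≤
        2 * ENNReal.ofReal (formConst d m n) * ∫⁻ x in P.toSet, Φ x := by
      intro P hP
      obtain ⟨hPD, hPQ⟩ := hStm P hP
      refine ih P hPD ?_ (hf.mono_set hPQ) (hg.mono_set hPQ)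
        fun Q hQ hQP hQs => hΦ Q hQ (hQP.trans hPQ) hQs
      -- A stopping cube has at most half the volume of `Q₀`, so it is a proper subcube and its side
      -- is at most half.
      have hne : P ≠ Q₀ := by
        rintro rfl
        have h1 := hJ.sum_vol
        have h2 := Finset.single_le_sum (f := fun R : Cube d => R.vol) (fun R _ => R.vol_pos.le) hP
        linarith [P.vol_pos]
      obtain ⟨k, hk⟩ := h.grid.exists_side_eq hQ₀ hPD (Cube.side_mono hd hPQ)
      obtain _ | k := k
      · exact absurd (h.grid.eq_of_subset hd hPD hQ₀ hPQ (by simp [hk])) hne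
      · have : P.side ≤ Q₀.side / 2 := by
          rw [hk]
          refine div_le_div_of_nonneg_left Q₀.side_pos.le two_pos ?_
          exact le_self_pow₀ one_le_two (Nat.succ_ne_zero k)
        rw [pow_succ] at hs
        linarith
    have hunion : ∫⁻ x in Q₀.toSet, Φ x =
        (∫⁻ x in E, Φ x) + ∑ P ∈ St, ∫⁻ x in P.toSet, Φ x := by
      rw [← lintegral_biUnion_finset hStD fun P _ => P.measurableSet_toSet,
        ← lintegral_union hUm Set.disjoint_sdiff_left,
        Set.sdiff_union_of_subset (Set.iUnion₂_subset fun P hP => (hStm P hP).2)]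
    rw [hsplit, hunion, mul_add, Finset.mul_sum]
    calc _ ≤ ENNReal.ofReal (|∑ Q ∈ G with ¬ ∃ P ∈ St, Q.toSet ⊆ P.toSet, form s Q f g| +
          ∑ P ∈ St, |∑ Q ∈ F with Q.toSet ⊆ P.toSet, form s Q f g|) :=
          ENNReal.ofReal_le_ofReal ((abs_add_le _ _).trans
            (add_le_add_right (Finset.abs_sum_le_sum_abs _ _) _))
      _ = ENNReal.ofReal |∑ Q ∈ G with ¬ ∃ P ∈ St, Q.toSet ⊆ P.toSet, form s Q f g| +
          ∑ P ∈ St, ENNReal.ofReal |∑ Q ∈ F with Q.toSet ⊆ P.toSet, form s Q f g| := by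
          rw [ENNReal.ofReal_add (abs_nonneg _) (Finset.sum_nonneg fun _ _ => abs_nonneg _),
            ENNReal.ofReal_sum_of_nonneg fun _ _ => abs_nonneg _]
      _ ≤ _ := add_le_add hmain (Finset.sum_le_sum hchild)

/-- The form over a finite family of cubes is controlled by the integral of any function which
dominates the products of averages over the cubes of a suitable finite family. -/
lemma IsHaarShift.exists_finset_ofReal_abs_sum_form_le {D : Set (Cube d)} {m n : ℕ}
    {s : Cube d → (Fin d → ℝ) → (Fin d → ℝ) → ℝ}
    {S : Lp ℝ 2 (volume : Measure (Fin d → ℝ)) →ₗ[ℝ] Lp ℝ 2 (volume : Measure (Fin d → ℝ))}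
    (h : IsHaarShift D m n s S) (hd : 0 < d) {f g : (Fin d → ℝ) → ℝ} (F : Finset (Cube d))
    (hF : ∀ Q ∈ F, Q ∈ D) (hf : ∀ Q : Cube d, IntegrableOn f Q.toSet)
    (hg : ∀ Q : Cube d, IntegrableOn g Q.toSet) :
    ∃ G : Finset (Cube d), (∀ Q ∈ G, Q ∈ D) ∧ ∀ Φ : (Fin d → ℝ) → ℝ≥0∞,
      (∀ Q ∈ G, ∀ x ∈ Q.toSet, ENNReal.ofReal (avg f Q * avg g Q) ≤ Φ x) →
      ENNReal.ofReal |∑ Q ∈ F, form s Q f g| ≤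
        2 * ENNReal.ofReal (formConst d m n) * ∫⁻ x, Φ x := by
  classical
  obtain ⟨ε, hε, hεF⟩ : ∃ ε : ℝ, 0 < ε ∧ ∀ Q ∈ F, ε ≤ Q.side := by
    rcases F.eq_empty_or_nonempty with rfl | hne
    · exact ⟨1, one_pos, by simp⟩
    · obtain ⟨Q, hQ, hmin⟩ := F.exists_min_image Cube.side hne
      exact ⟨Q.side, Q.side_pos, hmin⟩
  -- The maximal cubes of `F` split the sum into independent pieces. The witness `G`, all grid cubes
  -- of side at least `ε` below them, is finite and fixed before `Φ`, so `Φ` may be built from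
  -- maximal functions over `G`.
  obtain ⟨T, hTF, hTd, hTc, -⟩ := h.grid.exists_maximal hd F hF
  have hTfin : (⋃ P ∈ T, {R | R ∈ D ∧ R.toSet ⊆ P.toSet ∧ ε ≤ R.side}).Finite :=
    Set.Finite.biUnion T.finite_toSet fun P hP => h.grid.finite_subcubes hd (hF P (hTF hP)) hε
  refine ⟨hTfin.toFinset, fun Q hQ => ?_, fun Φ hΦ => ?_⟩
  · rw [Set.Finite.mem_toFinset] at hQ
    simp only [Set.mem_iUnion] at hQ
    obtain ⟨P, hP, hQ⟩ := hQ
    exact hQ.1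
  · have hsum : ∑ Q ∈ F, form s Q f g = ∑ P ∈ T, ∑ Q ∈ F with Q.toSet ⊆ P.toSet, form s Q f g := by
      rw [← sum_filter_exists_subset hTd, Finset.filter_true_of_mem hTc]
    have hT : ∀ P ∈ T, ENNReal.ofReal |∑ Q ∈ F with Q.toSet ⊆ P.toSet, form s Q f g| ≤
        2 * ENNReal.ofReal (formConst d m n) * ∫⁻ x in P.toSet, Φ x := by
      intro P hP
      obtain ⟨N, hN⟩ := pow_unbounded_of_one_lt (P.side / ε) (one_lt_two)
      refine h.ofReal_abs_sum_form_subset_le hd F (fun Q hQ => ⟨hF Q hQ, hεF Q hQ⟩) N P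
        (hF P (hTF hP)) ((div_lt_iff₀ hε).1 hN) (hf P) (hg P) fun Q hQ hQP hQs => hΦ Q ?_
      rw [Set.Finite.mem_toFinset]
      simp only [Set.mem_iUnion]
      exact ⟨P, hP, hQ, hQP, hQs⟩
    rw [hsum]
    calc _ ≤ ENNReal.ofReal (∑ P ∈ T, |∑ Q ∈ F with Q.toSet ⊆ P.toSet, form s Q f g|) :=
          ENNReal.ofReal_le_ofReal (Finset.abs_sum_le_sum_abs _ _)
      _ = ∑ P ∈ T, ENNReal.ofReal |∑ Q ∈ F with Q.toSet ⊆ P.toSet, form s Q f g| :=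
          ENNReal.ofReal_sum_of_nonneg fun _ _ => abs_nonneg _
      _ ≤ ∑ P ∈ T, 2 * ENNReal.ofReal (formConst d m n) * ∫⁻ x in P.toSet, Φ x :=
          Finset.sum_le_sum hT
      _ = 2 * ENNReal.ofReal (formConst d m n) * ∫⁻ x in ⋃ P ∈ T, P.toSet, Φ x := by
          rw [← Finset.mul_sum, lintegral_biUnion_finset hTd fun P _ => P.measurableSet_toSet]
      _ ≤ _ := mul_le_mul_right (setLIntegral_le_lintegral _ _) _

/-! ### Weighted measures and the weighted form bound -/

lemma eLpNorm_two_sq {α : Type*} [MeasurableSpace α] (f : α → ℝ) (μ : Measure α) :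
    eLpNorm f 2 μ ^ 2 = ∫⁻ x, ‖f x‖ₑ ^ 2 ∂μ := by
  have := eLpNorm_nnreal_pow_eq_lintegral (f := f) (μ := μ) (p := 2) two_ne_zero
  simpa using this

lemma setLIntegral_weightMeasure {w : (Fin d → ℝ) → ℝ} (hw : AEMeasurable w)
    (u : (Fin d → ℝ) → ℝ≥0∞) {A : Set (Fin d → ℝ)} (hA : MeasurableSet A) :
    ∫⁻ x in A, u x ∂(weightMeasure w) = ∫⁻ x in A, ENNReal.ofReal (w x) * u x := by
  rw [weightMeasure, setLIntegral_withDensity_eq_setLIntegral_mul_non_measurable₀ _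
    hw.ennreal_ofReal.restrict _ hA (ae_of_all _ fun x => ENNReal.ofReal_lt_top)]
  rfl

lemma lintegral_weightMeasure {w : (Fin d → ℝ) → ℝ} (hw : AEMeasurable w)
    (u : (Fin d → ℝ) → ℝ≥0∞) :
    ∫⁻ x, u x ∂(weightMeasure w) = ∫⁻ x, ENNReal.ofReal (w x) * u x := by
  simpa using setLIntegral_weightMeasure hw u MeasurableSet.univ

lemma A2Const_inv (w : (Fin d → ℝ) → ℝ) : A2Const (fun x => (w x)⁻¹) = A2Const w := by
  simp only [A2Const, inv_inv]
  exact iSup_congr fun Q => mul_comm _ _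

namespace IsA2Weight

variable {w : (Fin d → ℝ) → ℝ} (hw : IsA2Weight w)
include hw

lemma inv : IsA2Weight fun x => (w x)⁻¹ where
  aemeasurable := hw.aemeasurable.inv
  pos := hw.pos.mono fun _ hx => inv_pos.2 hx
  finite := by rw [A2Const_inv]; exact hw.finite

omit hw in
lemma weightMeasure_absolutelyContinuous : weightMeasure w ≪ volume :=
  withDensity_absolutelyContinuous _ _

lemma absolutelyContinuous_weightMeasure : volume ≪ weightMeasure w :=
  withDensity_absolutelyContinuous' hw.aemeasurable.ennreal_ofReal
    (hw.pos.mono fun _ hx => (ENNReal.ofReal_pos.2 hx).ne')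

lemma weightMeasure_ne_zero (Q : Cube d) : weightMeasure w Q.toSet ≠ 0 := fun h0 =>
  Q.volume_ne_zero (hw.absolutelyContinuous_weightMeasure h0)

omit hw in
lemma mul_le (Q : Cube d) : (weightMeasure w Q.toSet / volume Q.toSet) *
    (weightMeasure (fun x => (w x)⁻¹) Q.toSet / volume Q.toSet) ≤ A2Const w :=
  le_iSup (fun Q : Cube d => (weightMeasure w Q.toSet / volume Q.toSet) *
    (weightMeasure (fun x => (w x)⁻¹) Q.toSet / volume Q.toSet)) Q

lemma weightMeasure_ne_top (Q : Cube d) : weightMeasure w Q.toSet ≠ ∞ := by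
  intro htop
  -- The dual weight has positive mass on `Q`, so infinite mass of `w` there would make the product
  -- in `A2Const` infinite.
  have h1 := (mul_le Q).trans_lt hw.finite
  rw [htop, ENNReal.top_div_of_ne_top Q.volume_ne_top, ENNReal.top_mul] at h1
  · exact lt_irrefl _ h1
  · exact (ENNReal.div_pos (hw.inv.weightMeasure_ne_zero Q) Q.volume_ne_top).ne'

/-- A pointwise substitute for Cauchy–Schwarz, by completing the square. Both terms on the right
have finite integral over cubes when `f ∈ L²(w)`, so averages over cubes and components are well
behaved. -/
lemma enorm_le (f : (Fin d → ℝ) → ℝ) : ∀ᵐ x, ‖f x‖ₑ ≤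
    ENNReal.ofReal (w x) * ‖f x‖ₑ ^ 2 + ENNReal.ofReal (w x)⁻¹ := by
  filter_upwards [hw.pos] with x hx
  rw [Real.enorm_eq_ofReal_abs, ← ENNReal.ofReal_pow (abs_nonneg _), ← ENNReal.ofReal_mul hx.le,
    ← ENNReal.ofReal_add (by positivity) (by positivity)]
  refine ENNReal.ofReal_le_ofReal ?_
  have h1 : w x * |f x| ^ 2 + (w x)⁻¹ - |f x| =
      (w x)⁻¹ * ((w x * |f x| - 1 / 2) ^ 2 + 3 / 4) := by
    field_simp; ring
  have h2 : 0 ≤ (w x)⁻¹ * ((w x * |f x| - 1 / 2) ^ 2 + 3 / 4) := by positivity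
  linarith

lemma setLIntegral_enorm_lt_top {f : (Fin d → ℝ) → ℝ} (hf : MemLp f 2 (weightMeasure w))
    (Q : Cube d) : ∫⁻ x in Q.toSet, ‖f x‖ₑ < ∞ := by
  refine (lintegral_mono_ae (ae_restrict_of_ae (hw.enorm_le f))).trans_lt ?_
  rw [lintegral_add_right' _ hw.inv.aemeasurable.ennreal_ofReal.restrict]
  refine ENNReal.add_lt_top.2 ⟨?_, ?_⟩
  · refine (setLIntegral_le_lintegral _ _).trans_lt ?_
    rw [← lintegral_weightMeasure hw.aemeasurable, ← eLpNorm_two_sq]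
    exact ENNReal.pow_lt_top hf.2
  · have := hw.inv.weightMeasure_ne_top Q
    rw [weightMeasure, withDensity_apply _ Q.measurableSet_toSet] at this
    exact this.lt_top

lemma integrableOn {f : (Fin d → ℝ) → ℝ} (hf : MemLp f 2 (weightMeasure w)) (Q : Cube d) :
    IntegrableOn f Q.toSet :=
  ⟨(hf.1.mono_ac hw.absolutelyContinuous_weightMeasure).restrict,
    hw.setLIntegral_enorm_lt_top hf Q⟩

/-- The maximal function associated with the dual weight is bounded. -/
lemma lintegral_maxFun_sq_le {D : Set (Cube d)} (hD : IsDyadicGrid D) (hd : 0 < d)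
    {f : (Fin d → ℝ) → ℝ} (hf : MemLp f 2 (weightMeasure w)) (G : Finset (Cube d))
    (hG : ∀ Q ∈ G, Q ∈ D) :
    ∫⁻ x, maxFun G (fun Q => (∫⁻ x in Q.toSet, ‖f x‖ₑ) /
      weightMeasure (fun x => (w x)⁻¹) Q.toSet) x ^ 2 ∂(weightMeasure fun x => (w x)⁻¹) ≤
      4 * eLpNorm f 2 (weightMeasure w) ^ 2 := by
  have hfm : AEMeasurable f volume :=
    (hf.1.mono_ac hw.absolutelyContinuous_weightMeasure).aemeasurable
  have hone : ∀ᵐ x, ENNReal.ofReal (w x)⁻¹ * ENNReal.ofReal (w x) = 1 := by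
    filter_upwards [hw.pos] with x hx
    rw [← ENNReal.ofReal_mul (inv_pos.2 hx).le, inv_mul_cancel₀ hx.ne', ENNReal.ofReal_one]
  -- Since `dx = w dσ`, the ratios are `σ`-averages of `|f| w`, whose norm in `L²(σ)` is the norm of
  -- `f` in `L²(w)`.
  have h1 : ∀ Q : Cube d, ∫⁻ x in Q.toSet, ‖f x‖ₑ =
      ∫⁻ x in Q.toSet, ‖f x‖ₑ * ENNReal.ofReal (w x) ∂(weightMeasure fun x => (w x)⁻¹) := by
    intro Q
    rw [setLIntegral_weightMeasure hw.inv.aemeasurable _ Q.measurableSet_toSet]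
    refine lintegral_congr_ae (ae_restrict_of_ae ?_)
    filter_upwards [hone] with x hx
    rw [mul_left_comm, hx, mul_one]
  have h2 : ∫⁻ x, (‖f x‖ₑ * ENNReal.ofReal (w x)) ^ 2 ∂(weightMeasure fun x => (w x)⁻¹) =
      eLpNorm f 2 (weightMeasure w) ^ 2 := by
    rw [eLpNorm_two_sq, lintegral_weightMeasure hw.inv.aemeasurable,
      lintegral_weightMeasure hw.aemeasurable]
    refine lintegral_congr_ae ?_
    filter_upwards [hone] with x hx
    calc _ = ENNReal.ofReal (w x)⁻¹ * ENNReal.ofReal (w x) *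
          (ENNReal.ofReal (w x) * ‖f x‖ₑ ^ 2) := by ring
      _ = _ := by rw [hx, one_mul]
  rw [← h2]
  simp only [h1]
  refine hD.lintegral_maxFun_sq_le hd G hG _
    ((hfm.enorm.mul hw.aemeasurable.ennreal_ofReal).mono_ac weightMeasure_absolutelyContinuous)
    (fun Q _ => hw.inv.weightMeasure_ne_top Q) fun Q _ => ?_
  rw [← h1]
  exact ENNReal.div_ne_top (hw.setLIntegral_enorm_lt_top hf Q).ne (hw.inv.weightMeasure_ne_zero Q)

/-- Cauchy–Schwarz after inserting `1 = σ^{1/2} w^{1/2}` under the Lebesgue integral. -/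
lemma lintegral_mul_le {M₁ M₂ : (Fin d → ℝ) → ℝ≥0∞} (h1 : Measurable M₁) (h2 : Measurable M₂) :
    ∫⁻ x, M₁ x * M₂ x ≤ (∫⁻ x, M₁ x ^ 2 ∂(weightMeasure fun x => (w x)⁻¹)) ^ (1 / 2 : ℝ) *
      (∫⁻ x, M₂ x ^ 2 ∂(weightMeasure w)) ^ (1 / 2 : ℝ) := by
  have hσm := hw.inv.aemeasurable.ennreal_ofReal.pow_const (1 / 2 : ℝ)
  have hwm := hw.aemeasurable.ennreal_ofReal.pow_const (1 / 2 : ℝ)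
  have e1 : ∫⁻ x, M₁ x * M₂ x = ∫⁻ x, ((fun x => M₁ x * ENNReal.ofReal (w x)⁻¹ ^ (1 / 2 : ℝ)) *
      fun x => M₂ x * ENNReal.ofReal (w x) ^ (1 / 2 : ℝ)) x := by
    refine lintegral_congr_ae ?_
    filter_upwards [hw.pos] with x hx
    have : ENNReal.ofReal (w x)⁻¹ ^ (1 / 2 : ℝ) * ENNReal.ofReal (w x) ^ (1 / 2 : ℝ) = 1 := by
      rw [← ENNReal.mul_rpow_of_nonneg _ _ (by norm_num), ← ENNReal.ofReal_mul (inv_pos.2 hx).le,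
        inv_mul_cancel₀ hx.ne', ENNReal.ofReal_one, ENNReal.one_rpow]
    rw [Pi.mul_apply, mul_mul_mul_comm, this, mul_one]
  have hsq : ∀ a b : ℝ≥0∞, (a * b ^ (1 / 2 : ℝ)) ^ (2 : ℝ) = b * a ^ 2 := by
    intro a b
    rw [ENNReal.mul_rpow_of_nonneg _ _ zero_le_two, ← ENNReal.rpow_mul, ENNReal.rpow_two]
    norm_num [mul_comm]
  have hm1 : AEMeasurable (fun x => M₁ x * ENNReal.ofReal (w x)⁻¹ ^ (1 / 2 : ℝ)) volume :=
    h1.aemeasurable.mul hσm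
  have hm2 : AEMeasurable (fun x => M₂ x * ENNReal.ofReal (w x) ^ (1 / 2 : ℝ)) volume :=
    h2.aemeasurable.mul hwm
  rw [e1]
  refine (ENNReal.lintegral_mul_le_Lp_mul_Lq volume Real.HolderConjugate.two_two
    hm1 hm2).trans (le_of_eq ?_)
  simp only [hsq]
  rw [lintegral_weightMeasure hw.inv.aemeasurable, lintegral_weightMeasure hw.aemeasurable]

end IsA2Weight

lemma ofReal_avg {f : (Fin d → ℝ) → ℝ} {Q : Cube d} (hf : IntegrableOn f Q.toSet) :
    ENNReal.ofReal (avg f Q) = (∫⁻ x in Q.toSet, ‖f x‖ₑ) / volume Q.toSet := by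
  rw [avg, ENNReal.ofReal_div_of_pos Q.vol_pos, Cube.ofReal_vol]
  congr 1
  exact ofReal_integral_norm_eq_lintegral_enorm hf

/-- The weighted bound for the bilinear form of a Haar shift. -/
lemma IsHaarShift.ofReal_abs_sum_form_le {D : Set (Cube d)} {m n : ℕ}
    {s : Cube d → (Fin d → ℝ) → (Fin d → ℝ) → ℝ}
    {S : Lp ℝ 2 (volume : Measure (Fin d → ℝ)) →ₗ[ℝ] Lp ℝ 2 (volume : Measure (Fin d → ℝ))}
    (h : IsHaarShift D m n s S) (hd : 0 < d) {w : (Fin d → ℝ) → ℝ} (hw : IsA2Weight w)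
    {f g : (Fin d → ℝ) → ℝ} (hf : MemLp f 2 (weightMeasure w))
    (hg : MemLp g 2 (weightMeasure fun x => (w x)⁻¹)) (F : Finset (Cube d))
    (hF : ∀ Q ∈ F, Q ∈ D) :
    ENNReal.ofReal |∑ Q ∈ F, form s Q f g| ≤
      8 * ENNReal.ofReal (formConst d m n) * A2Const w *
        (eLpNorm f 2 (weightMeasure w) * eLpNorm g 2 (weightMeasure fun x => (w x)⁻¹)) := by
  have hfI := hw.integrableOn hf
  have hgI := hw.inv.integrableOn hg
  obtain ⟨G, hG, hGΦ⟩ := h.exists_finset_ofReal_abs_sum_form_le hd F hF hfI hgI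
  set σ : (Fin d → ℝ) → ℝ := fun x => (w x)⁻¹ with hσ
  set M₁ := maxFun G fun Q => (∫⁻ x in Q.toSet, ‖f x‖ₑ) / weightMeasure σ Q.toSet with hM₁
  set M₂ := maxFun G fun Q => (∫⁻ x in Q.toSet, ‖g x‖ₑ) / weightMeasure w Q.toSet with hM₂
  have hM₁m : Measurable M₁ := measurable_maxFun _ _
  have hM₂m : Measurable M₂ := measurable_maxFun _ _
  have b1 := hw.lintegral_maxFun_sq_le h.grid hd hf G hG
  have b2 := hw.inv.lintegral_maxFun_sq_le h.grid hd hg G hG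
  simp only [inv_inv] at b2
  -- Multiplying and dividing by `σ(Q)` and `w(Q)` isolates the `A₂` ratio; the remaining two
  -- factors are dominated by the maximal functions at every point of `Q`.
  have key := hGΦ (fun x => A2Const w * (M₁ x * M₂ x)) (by
    intro Q hQ x hx
    have p1 : (∫⁻ x in Q.toSet, ‖f x‖ₑ) / volume Q.toSet =
        (∫⁻ x in Q.toSet, ‖f x‖ₑ) / weightMeasure σ Q.toSet *
          (weightMeasure σ Q.toSet / volume Q.toSet) := by
      rw [← mul_div_assoc, ENNReal.div_mul_cancel (hw.inv.weightMeasure_ne_zero Q)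
        (hw.inv.weightMeasure_ne_top Q)]
    have p2 : (∫⁻ x in Q.toSet, ‖g x‖ₑ) / volume Q.toSet =
        (∫⁻ x in Q.toSet, ‖g x‖ₑ) / weightMeasure w Q.toSet *
          (weightMeasure w Q.toSet / volume Q.toSet) := by
      rw [← mul_div_assoc, ENNReal.div_mul_cancel (hw.weightMeasure_ne_zero Q)
        (hw.weightMeasure_ne_top Q)]
    rw [ENNReal.ofReal_mul (avg_nonneg _ _), ofReal_avg (hfI Q), ofReal_avg (hgI Q), p1, p2]
    calc _ = (weightMeasure w Q.toSet / volume Q.toSet *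
            (weightMeasure σ Q.toSet / volume Q.toSet)) *
          ((∫⁻ x in Q.toSet, ‖f x‖ₑ) / weightMeasure σ Q.toSet *
            ((∫⁻ x in Q.toSet, ‖g x‖ₑ) / weightMeasure w Q.toSet)) := by ring
      _ ≤ _ := mul_le_mul' (IsA2Weight.mul_le Q) (mul_le_mul'
          (le_maxFun (a := fun Q => (∫⁻ x in Q.toSet, ‖f x‖ₑ) / weightMeasure σ Q.toSet) hQ hx)
          (le_maxFun (a := fun Q => (∫⁻ x in Q.toSet, ‖g x‖ₑ) / weightMeasure w Q.toSet) hQ hx)))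
  refine key.trans ?_
  rw [lintegral_const_mul (f := fun x => M₁ x * M₂ x) _ (hM₁m.mul hM₂m)]
  have hroot : ∀ a : ℝ≥0∞, (4 * a ^ 2) ^ (1 / 2 : ℝ) = 2 * a := by
    intro a
    have : (4 : ℝ≥0∞) * a ^ 2 = (2 * a) ^ (2 : ℝ) := by
      rw [ENNReal.rpow_two, mul_pow]; norm_num
    rw [this, ← ENNReal.rpow_mul]; norm_num
  -- Each Doob constant `4` contributes `2` to the norm; with the `2` from the stopping argument
  -- this gives the final `8`.
  have hhold : ∫⁻ x, M₁ x * M₂ x ≤ 4 * (eLpNorm f 2 (weightMeasure w) *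
      eLpNorm g 2 (weightMeasure σ)) := by
    refine (hw.lintegral_mul_le hM₁m hM₂m).trans ?_
    calc _ ≤ (4 * eLpNorm f 2 (weightMeasure w) ^ 2) ^ (1 / 2 : ℝ) *
          (4 * eLpNorm g 2 (weightMeasure σ) ^ 2) ^ (1 / 2 : ℝ) :=
          mul_le_mul' (ENNReal.rpow_le_rpow b1 (by norm_num))
            (ENNReal.rpow_le_rpow b2 (by norm_num))
      _ = _ := by rw [hroot, hroot]; ring
  calc _ ≤ 2 * ENNReal.ofReal (formConst d m n) * (A2Const w * (4 * (eLpNorm f 2 (weightMeasure w) *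
        eLpNorm g 2 (weightMeasure σ)))) := by gcongr
    _ = _ := by ring

/-! ### Unconditional convergence and identification of the limit -/

/-- In a Hilbert space, a series with bounded finite partial sums converges unconditionally. -/
lemma summable_of_norm_sum_le {ι E : Type*} [NormedAddCommGroup E] [InnerProductSpace ℝ E]
    [CompleteSpace E] {u : ι → E} {B : ℝ} (hB : ∀ F : Finset ι, ‖∑ i ∈ F, u i‖ ≤ B) :
    Summable u := by
  classical
  rw [summable_iff_vanishing_norm]
  by_contra! hcon
  obtain ⟨ε, hε, hcon⟩ := hcon
  -- Failure of the Cauchy criterion yields disjoint blocks of norm at least `ε`. Giving each new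
  -- block the sign that makes its inner product with the previous sum favourable increases the
  -- squared norm by at least `ε²`, while `P` and `M`, the indices with plus and minus signs, keep
  -- the norm below `2B`.
  have key : ∀ N : ℕ, ∃ P M : Finset ι, N * ε ^ 2 ≤ ‖∑ i ∈ P, u i - ∑ i ∈ M, u i‖ ^ 2 := by
    intro N
    induction N with
    | zero => exact ⟨∅, ∅, by simp⟩
    | succ N ih =>
      obtain ⟨P, M, hPM⟩ := ih
      obtain ⟨t, ht, htε⟩ := hcon (P ∪ M)
      rw [Finset.disjoint_union_right] at ht
      set v := ∑ i ∈ P, u i - ∑ i ∈ M, u i with hv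
      set z := ∑ i ∈ t, u i with hz
      have hz2 : ε ^ 2 ≤ ‖z‖ ^ 2 := pow_le_pow_left₀ hε.le htε 2
      push_cast
      rcases le_total 0 (inner ℝ v z) with hi | hi
      · refine ⟨P ∪ t, M, ?_⟩
        have : ∑ i ∈ P ∪ t, u i - ∑ i ∈ M, u i = v + z := by
          rw [Finset.sum_union ht.1.symm]; simp only [hv, hz]; abel
        rw [this, norm_add_sq_real]
        linarith
      · refine ⟨P, M ∪ t, ?_⟩
        have : ∑ i ∈ P, u i - ∑ i ∈ M ∪ t, u i = v - z := by
          rw [Finset.sum_union ht.2.symm]; simp only [hv, hz]; abel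
        rw [this, norm_sub_sq_real]
        linarith
  obtain ⟨N, hN⟩ := exists_nat_gt ((2 * B) ^ 2 / ε ^ 2)
  rw [div_lt_iff₀ (by positivity)] at hN
  obtain ⟨P, M, hPM⟩ := key N
  have h1 : ‖∑ i ∈ P, u i - ∑ i ∈ M, u i‖ ≤ 2 * B := by
    linarith [norm_sub_le (∑ i ∈ P, u i) (∑ i ∈ M, u i), hB P, hB M]
  have h2 := pow_le_pow_left₀ (norm_nonneg _) h1 2
  linarith

namespace IsHaarShift

variable {D : Set (Cube d)} {m n : ℕ} {s : Cube d → (Fin d → ℝ) → (Fin d → ℝ) → ℝ}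
  {S : Lp ℝ 2 (volume : Measure (Fin d → ℝ)) →ₗ[ℝ] Lp ℝ 2 (volume : Measure (Fin d → ℝ))}
  (h : IsHaarShift D m n s S) (hd : 0 < d) {w : (Fin d → ℝ) → ℝ} (hw : IsA2Weight w)
include h hd hw

lemma memLp_component {f : (Fin d → ℝ) → ℝ} (hf : MemLp f 2 (weightMeasure w)) {Q : Cube d}
    (hQ : Q ∈ D) : MemLp (component s Q f) 2 (weightMeasure w) := by
  refine (memLp_indicator_const 2 Q.measurableSet_toSet ((∫ y in Q.toSet, |f y|) / Q.vol)
    (Or.inr (hw.weightMeasure_ne_top Q))).mono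
    (h.measurable_component hd hQ f).aestronglyMeasurable (ae_of_all _ fun x => ?_)
  by_cases hx : x ∈ Q.toSet
  · rw [Set.indicator_of_mem hx]
    exact (h.abs_component_le hQ (hw.integrableOn hf Q) x).trans (le_abs_self _)
  · rw [h.component_eq_zero_of_notMem hQ f hx, norm_zero]
    exact norm_nonneg _

/-- Duality with an explicit test function: for the partial sum `v`, the function `g = v w` has norm
in `L²(σ)` equal to that of `v` in `L²(w)`, and pairing it with `v` gives the square of that norm.
-/
lemma weighted_eLpNorm_sum_component_le {f : (Fin d → ℝ) → ℝ} (hf : MemLp f 2 (weightMeasure w))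
    (F : Finset (Cube d)) (hF : ∀ Q ∈ F, Q ∈ D) :
    eLpNorm (fun x => ∑ Q ∈ F, component s Q f x) 2 (weightMeasure w) ≤
      8 * ENNReal.ofReal (formConst d m n) * A2Const w * eLpNorm f 2 (weightMeasure w) := by
  set v : (Fin d → ℝ) → ℝ := fun x => ∑ Q ∈ F, component s Q f x with hv
  have hvL : MemLp v 2 (weightMeasure w) :=
    memLp_finsetSum F fun Q hQ => h.memLp_component hd hw hf (hF Q hQ)
  have hvm : Measurable v := Finset.measurable_fun_sum F fun Q hQ =>
    h.measurable_component hd (hF Q hQ) f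
  set g : (Fin d → ℝ) → ℝ := fun x => v x * w x with hg
  have hgm : AEStronglyMeasurable g volume :=
    (hvm.aemeasurable.mul hw.aemeasurable).aestronglyMeasurable
  have hpt : ∀ᵐ x, ENNReal.ofReal (w x)⁻¹ * ‖g x‖ₑ ^ 2 = ENNReal.ofReal (w x) * ‖v x‖ₑ ^ 2 := by
    filter_upwards [hw.pos] with x hx
    have e1 : ‖w x‖ₑ = ENNReal.ofReal (w x) := by
      rw [Real.enorm_eq_ofReal_abs, abs_of_pos hx]
    have e2 : ENNReal.ofReal (w x)⁻¹ * ENNReal.ofReal (w x) = 1 := by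
      rw [← ENNReal.ofReal_mul (inv_pos.2 hx).le, inv_mul_cancel₀ hx.ne', ENNReal.ofReal_one]
    rw [hg]
    simp only
    rw [enorm_mul, e1]
    calc _ = ENNReal.ofReal (w x)⁻¹ * ENNReal.ofReal (w x) *
          (ENNReal.ofReal (w x) * ‖v x‖ₑ ^ 2) := by ring
      _ = _ := by rw [e2, one_mul]
  have hnorm : eLpNorm g 2 (weightMeasure fun x => (w x)⁻¹) = eLpNorm v 2 (weightMeasure w) := by
    have : eLpNorm g 2 (weightMeasure fun x => (w x)⁻¹) ^ 2 =
        eLpNorm v 2 (weightMeasure w) ^ 2 := by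
      rw [eLpNorm_two_sq, eLpNorm_two_sq, lintegral_weightMeasure hw.inv.aemeasurable,
        lintegral_weightMeasure hw.aemeasurable]
      exact lintegral_congr_ae hpt
    exact (ENNReal.pow_right_strictMono two_ne_zero).injective this
  have hgL : MemLp g 2 (weightMeasure fun x => (w x)⁻¹) :=
    ⟨hgm.mono_ac IsA2Weight.weightMeasure_absolutelyContinuous, hnorm ▸ hvL.2⟩
  have hform : eLpNorm v 2 (weightMeasure w) ^ 2 = ENNReal.ofReal (∑ Q ∈ F, form s Q f g) := by
    have hint : ∀ Q ∈ F, Integrable (fun x => component s Q f x * g x) volume := fun Q hQ => by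
      refine (integrableOn_iff_integrable_of_support_subset fun x hx => ?_).1
        (h.integrableOn_component_mul hd (hF Q hQ) (hw.integrableOn hf Q)
          (hw.inv.integrableOn hgL Q))
      by_contra hxQ
      exact hx (mul_eq_zero_of_left (h.component_eq_zero_of_notMem (hF Q hQ) f hxQ) _)
    have hsum : ∑ Q ∈ F, form s Q f g = ∫ x, v x * g x := by
      simp only [hv, Finset.sum_mul]
      rw [integral_finsetSum F hint]
      refine Finset.sum_congr rfl fun Q hQ => ?_
      rw [form]
      refine setIntegral_eq_integral_of_forall_compl_eq_zero fun x hx => ?_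
      rw [h.component_eq_zero_of_notMem (hF Q hQ) f hx, zero_mul]
    have hvint : Integrable (fun x => v x * g x) volume := by
      simp only [hv, Finset.sum_mul]
      exact integrable_finsetSum F hint
    rw [hsum, ofReal_integral_eq_lintegral_ofReal hvint, eLpNorm_two_sq,
      lintegral_weightMeasure hw.aemeasurable]
    · refine lintegral_congr_ae ?_
      filter_upwards [hw.pos] with x hx
      rw [Real.enorm_eq_ofReal_abs, ← ENNReal.ofReal_pow (abs_nonneg _), ← ENNReal.ofReal_mul hx.le,
        sq_abs]
      congr 1
      simp only [hg]; ring
    · filter_upwards [hw.pos] with x hx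
      have : v x * g x = v x ^ 2 * w x := by simp only [hg]; ring
      rw [Pi.zero_apply, this]
      positivity
  have key := h.ofReal_abs_sum_form_le hd hw hf hgL F hF
  rw [hnorm, ← mul_assoc] at key
  have key2 : eLpNorm v 2 (weightMeasure w) * eLpNorm v 2 (weightMeasure w) ≤
      8 * ENNReal.ofReal (formConst d m n) * A2Const w * eLpNorm f 2 (weightMeasure w) *
        eLpNorm v 2 (weightMeasure w) := by
    rw [← sq, hform]
    exact (ENNReal.ofReal_le_ofReal (le_abs_self _)).trans key
  -- One factor of the norm of `v` is cancelled, which is legitimate because it is known to be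
  -- finite.
  rcases eq_or_ne (eLpNorm v 2 (weightMeasure w)) 0 with h0 | h0
  · rw [h0]; exact zero_le
  · exact (ENNReal.mul_le_mul_iff_left h0 hvL.2.ne).1 key2

end IsHaarShift

/-- If a net converges in the norms of `L²(μ)` and of `L²(ν)`, where `μ` and `ν` have the same null
sets, then the limits agree. -/
lemma ae_eq_of_tendsto_eLpNorm {α ι : Type*} [MeasurableSpace α] {μ ν : Measure α} (hμν : μ ≪ ν)
    {l : Filter ι} [l.NeBot] {u : ι → α → ℝ} {g₁ g₂ : α → ℝ}
    (hu : ∀ i, Measurable (u i)) (h₁ : AEStronglyMeasurable g₁ μ) (h₂ : AEStronglyMeasurable g₂ ν)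
    (t₁ : Tendsto (fun i => eLpNorm (fun x => g₁ x - u i x) 2 μ) l (𝓝 0))
    (t₂ : Tendsto (fun i => eLpNorm (fun x => g₂ x - u i x) 2 ν) l (𝓝 0)) : g₁ =ᵐ[μ] g₂ := by
  -- A general net has no a.e. convergent subsequence to hand, so a sequence of indices that is good
  -- for both norms is chosen first; two successive subsequences then converge a.e.
  have hex : ∀ k : ℕ, ∃ i, eLpNorm (fun x => g₁ x - u i x) 2 μ < (k : ℝ≥0∞)⁻¹ ∧
      eLpNorm (fun x => g₂ x - u i x) 2 ν < (k : ℝ≥0∞)⁻¹ := fun k =>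
    ((t₁.eventually (gt_mem_nhds (by simp))).and (t₂.eventually (gt_mem_nhds (by simp)))).exists
  choose i hi using hex
  have c₁ : Tendsto (fun k => eLpNorm (u (i k) - g₁) 2 μ) atTop (𝓝 0) := by
    refine tendsto_of_tendsto_of_tendsto_of_le_of_le tendsto_const_nhds
      ENNReal.tendsto_inv_nat_nhds_zero (fun _ => zero_le) fun k => ?_
    rw [eLpNorm_sub_comm]
    exact (hi k).1.le
  have c₂ : Tendsto (fun k => eLpNorm (u (i k) - g₂) 2 ν) atTop (𝓝 0) := by
    refine tendsto_of_tendsto_of_tendsto_of_le_of_le tendsto_const_nhds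
      ENNReal.tendsto_inv_nat_nhds_zero (fun _ => zero_le) fun k => ?_
    rw [eLpNorm_sub_comm]
    exact (hi k).2.le
  obtain ⟨φ, hφ, hφt⟩ := (tendstoInMeasure_of_tendsto_eLpNorm two_ne_zero
    (fun k => (hu (i k)).aestronglyMeasurable) h₁ c₁).exists_seq_tendsto_ae
  obtain ⟨ψ, hψ, hψt⟩ := (tendstoInMeasure_of_tendsto_eLpNorm two_ne_zero
    (fun k => (hu (i (φ k))).aestronglyMeasurable) h₂
      (c₂.comp hφ.tendsto_atTop)).exists_seq_tendsto_ae
  filter_upwards [hφt, hμν.ae_le hψt] with x hx₁ hx₂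
  exact tendsto_nhds_unique (hx₁.comp hψ.tendsto_atTop) hx₂

lemma formConst_le (d m n : ℕ) :
    ENNReal.ofReal (formConst d m n) ≤
      ((16 * (4 ^ d + 1) : ℝ≥0) : ℝ≥0∞) * (complexity m n : ℝ≥0∞) := by
  have h1 : (1 : ℝ) ≤ complexity m n := by 
    rw [complexity]
    push_cast
    linarith [le_max_left (m : ℝ) n, (Nat.cast_nonneg m : (0 : ℝ) ≤ m)]
  have h2 : formConst d m n ≤ ((16 * (4 ^ d + 1) * complexity m n : ℝ≥0) : ℝ) := by
    rw [formConst]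
    push_cast
    have : (0 : ℝ) ≤ 4 ^ d * (complexity m n - 1) := mul_nonneg (by positivity) (by linarith)
    nlinarith
  calc ENNReal.ofReal (formConst d m n)
      ≤ ENNReal.ofReal ((16 * (4 ^ d + 1) * complexity m n : ℝ≥0) : ℝ) :=
        ENNReal.ofReal_le_ofReal h2
    _ = _ := by rw [ENNReal.ofReal_coe_nnreal]; push_cast; rfl

end HaarShift

theorem theorem2 (d : ℕ) (hd : 0 < d) :
    ∃ C : ℝ≥0, ∀ (D : Set (HaarShift.Cube d)) (m n : ℕ)
      (s : HaarShift.Cube d → (Fin d → ℝ) → (Fin d → ℝ) → ℝ)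
      (S : Lp ℝ 2 (volume : Measure (Fin d → ℝ)) →ₗ[ℝ] Lp ℝ 2 (volume : Measure (Fin d → ℝ))),
      HaarShift.IsHaarShift D m n s S →
      ∀ w : (Fin d → ℝ) → ℝ, HaarShift.IsA2Weight w →
      ∀ f : (Fin d → ℝ) → ℝ, MemLp f 2 (HaarShift.weightMeasure w) →
      ∃ g : (Fin d → ℝ) → ℝ, MemLp g 2 (HaarShift.weightMeasure w) ∧
        HaarShift.HasL2Sum (HaarShift.weightMeasure w) D
          (fun Q => HaarShift.component s Q f) g ∧
        (∀ hf : MemLp f 2 (volume : Measure (Fin d → ℝ)), S (hf.toLp f) =ᵐ[volume] g) ∧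
        eLpNorm g 2 (HaarShift.weightMeasure w) ≤
          (C : ℝ≥0∞) * (HaarShift.complexity m n : ℝ≥0∞) * HaarShift.A2Const w *
            eLpNorm f 2 (HaarShift.weightMeasure w) := by
  -- The factor `8` comes from the weighted form bound, and `4 ^ d + κ ≤ (4 ^ d + 1) κ` since `κ ≥
  -- 1`.
  refine ⟨8 * (16 * (4 ^ d + 1)), fun D m n s S h w hw f hf => ?_⟩
  set μ := HaarShift.weightMeasure w with hμ
  set K := 8 * ENNReal.ofReal (HaarShift.formConst d m n) * HaarShift.A2Const w * eLpNorm f 2 μ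
    with hK
  have hKt : K < ∞ := ENNReal.mul_lt_top (ENNReal.mul_lt_top
    (ENNReal.mul_lt_top (by simp) ENNReal.ofReal_lt_top) hw.finite) hf.2
  have hcL : ∀ Q : D, MemLp (HaarShift.component s (Q : HaarShift.Cube d) f) 2 μ := fun Q =>
    h.memLp_component hd hw hf Q.2
  set u : D → Lp ℝ 2 μ := fun Q => (hcL Q).toLp _ with hu
  have hsum : ∀ F : Finset D, (∑ Q ∈ F, u Q : Lp ℝ 2 μ) =ᵐ[μ]
      fun x => ∑ Q ∈ F, HaarShift.component s (Q : HaarShift.Cube d) f x := by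
    intro F
    have hall : ∀ᵐ x ∂μ, ∀ Q ∈ F, u Q x = HaarShift.component s (Q : HaarShift.Cube d) f x :=
      (ae_ball_iff F.countable_toSet).2 fun Q _ => (hcL Q).coeFn_toLp
    filter_upwards [Lp.coeFn_finsetSum F u, hall] with x hx hx'
    rw [hx, Finset.sum_apply]
    exact Finset.sum_congr rfl hx'
  have hbound : ∀ F : Finset D, ‖∑ Q ∈ F, u Q‖ ≤ K.toReal := by
    intro F
    rw [Lp.norm_def]
    refine ENNReal.toReal_mono hKt.ne ?_
    rw [eLpNorm_congr_ae (hsum F)]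
    have := h.weighted_eLpNorm_sum_component_le hd hw hf
      (F.map (Function.Embedding.subtype _)) (by
        intro Q hQ
        obtain ⟨R, -, rfl⟩ := Finset.mem_map.1 hQ
        exact R.2)
    simp only [Finset.sum_map] at this
    exact this
  have hS : Summable u := HaarShift.summable_of_norm_sum_le hbound
  have hL2 : HaarShift.HasL2Sum μ D (fun Q => HaarShift.component s Q f)
      (∑' Q, u Q : Lp ℝ 2 μ) := by
    have h1 := tendsto_iff_edist_tendsto_0.1 hS.hasSum
    refine h1.congr fun F => ?_
    rw [edist_comm, Lp.edist_def]
    refine eLpNorm_congr_ae ?_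
    filter_upwards [hsum F] with x hx
    rw [Pi.sub_apply, hx]
  refine ⟨(∑' Q, u Q : Lp ℝ 2 μ), Lp.memLp _, hL2, fun hf2 => ?_, ?_⟩
  · have hcomp : ∀ Q, HaarShift.component s Q (hf2.toLp f) = HaarShift.component s Q f := by
      intro Q
      ext x
      refine integral_congr_ae (ae_restrict_of_ae ?_)
      filter_upwards [hf2.coeFn_toLp] with y hy
      rw [hy]
    have h1 := h.sum_eq (hf2.toLp f)
    simp only [hcomp] at h1
    -- The same partial sums converge to `S f` in `L²(dx)` and to the new limit in `L²(w)`, and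
    -- Lebesgue measure is absolutely continuous with respect to `w dx`.
    exact HaarShift.ae_eq_of_tendsto_eLpNorm hw.absolutelyContinuous_weightMeasure
      (fun F : Finset D => Finset.measurable_fun_sum F fun Q _ => h.measurable_component hd Q.2 f)
      (Lp.aestronglyMeasurable _) (Lp.aestronglyMeasurable _) h1 hL2
  · have h1 : ‖∑' Q, u Q‖ ≤ K.toReal :=
      le_of_tendsto (hS.hasSum.norm) (Eventually.of_forall hbound)
    rw [Lp.norm_def, ENNReal.toReal_le_toReal (Lp.eLpNorm_ne_top _) hKt.ne] at h1
    refine h1.trans ?_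
    calc K ≤ 8 * (((16 * (4 ^ d + 1) : ℝ≥0) : ℝ≥0∞) * (HaarShift.complexity m n : ℝ≥0∞)) *
          HaarShift.A2Const w * eLpNorm f 2 μ := by
          rw [hK]
          gcongr
          exact HaarShift.formConst_le d m n
      _ = _ := by push_cast; ring
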